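/- All Hilbert spaces are complex; inner products $(\cdot,\cdot)$ and sesquilinear forms are linear in the first variable and conjugate-linear in the second. A strong symplectic structure on a Hilbert space $H$ is a continuous sesquilinear form $[\cdot,\cdot]$ with $[y,x]=-\overline{[x,y]}$ that is non-degenerate and for which $x\mapsto[\cdot,x]$ maps $H$ onto its dual $H^*$. Put $L^{\perp_s}=\{x:[x,y]=0\ \forall y\in L\}$; a closed subspace $L$ is isotropic if $[x,y]=0$ for all $x,y\in L$, and then $L^{\perp_s}/L$ carries the quotient form $[[x],[y]]_q=[x,y]$. On $H_+\oplus H_-$ the standard structure is $[x,y]_{st}=i(x_1,y_1)-i(x_2,y_2)$. $W_+(H)$ is the set of closed subspaces $L$ that are maximal among the subspaces on which $-i[x,x]>0$ for $x\neq0$ and satisfy $-i[x,x]\ge c_L\|x\|^2$ on $L$ for some $c_L>0$; it is a complex manifold with the global charts $\{x+Bx: x\in L\}\mapsto B\in\mathbb B(L,L^{\perp_s})$, $L\in W_+(H)$. A symplectic isomorphism is a topological linear isomorphism that preserves the forms. Let $H$ be a strong symplectic Hilbert space and $N:\mathbb D\to W_+(H)$ a Nevanlinna disc, i.e. a holomorphic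 map. Let $\mathbb D_\pm$ be two copies of the unit disc $\mathbb D$; for $\lambda$ in one copy, $\bar\lambda$ is taken in the other. Put $\mathcal N(\lambda)=N(\lambda)$ on $\mathbb D_+$, $\mathcal N(\lambda)=N(\bar\lambda)^{\perp_s}$ on $\mathbb D_-$, with Hermitian structure $\mp i[\cdot,\cdot]$ on $\mathcal N(\lambda)$ for $\lambda\in\mathbb D_\pm$. Let $F^\dagger_\lambda=\mathcal N(\bar\lambda)$, with the Hermitian structure $(\cdot,\cdot)_\lambda$ of $\mathcal N(\bar\lambda)$, let $F_\lambda$ be its conjugate-linear dual, and $\mathcal P_\lambda$ the projection of $H$ onto $F^\dagger_\lambda$ along $F^\dagger_{\bar\lambda}$. For $\omega\in F^\dagger_\mu$ let $\mathcal Q(\lambda,\mu)\omega=(\mathcal P_\lambda\omega,\cdot)_\lambda\in F_\lambda$, and let $K(\lambda,\mu)=\mathcal Q(\lambda,\mu)/(1-\lambda\bar\mu)$ if $\lambda,\mu$ lie in the same copy of the disc and $K(\lambda,\mu)=-\mathcal Q(\lambda,\mu)/(\lambda-\bar\mu)$ if they lie in different copies, the value at $\lambda=\bar\mu$ being the limit.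 Then $K$ is a positive kernel. Let $\mathfrak H$ be the reproducing kernel Hilbert space of sections of $F$ that it generates, let $\mathbb H=\mathfrak H\oplus\mathfrak H$ with its standard structure, and let $$\mathfrak A=\{(f,g)\in\mathbb H:\ g(\lambda)=\lambda f(\lambda)\ \forall\lambda\in\mathbb D_+,\quad f(\lambda)=\lambda g(\lambda)\ \forall\lambda\in\mathbb D_-\}.$$ 1. $\mathfrak A$ is isotropic in $\mathbb H$, and $\mathfrak A^{\perp_s}/\mathfrak A$ with the quotient form is strong symplectic. 2. For $\lambda\in\mathbb D_+$ (resp. $\lambda\in\mathbb D_-$) let $N_\lambda$ be the set of all elements of $\mathfrak A^{\perp_s}$ of the form $(f,\lambda f)$ (resp. $(\lambda f,f)$), and let $W(\lambda)$, the Weyl curve of $\mathfrak A$, be the image of $N_\lambda$ in $\mathfrak A^{\perp_s}/\mathfrak A$. Then $W|_{\mathbb D_+}$ is a Nevanlinna disc, $W(\lambda)=W(\bar\lambda)^{\perp_s}$ for $\lambda\in\mathbb D_-$, and $W$ is congruent to $N$: some symplectic isomorphism $\mathfrak A^{\perp_s}/\mathfrak A\to H$ maps $W(\lambda)$ onto $N(\lambda)$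 for all $\lambda\in\mathbb D_+$. 3. There are Hilbert spaces $H_\pm$, a symplectic isomorphism of $H$ with the standard space $H_+\oplus H_-$ and a holomorphic $B:\mathbb D\to\mathbb B(H_+,H_-)$ with $\|B(\lambda)\|<1$ such that $N(\lambda)$ becomes $\{(x,B(\lambda)x):x\in H_+\}$ for all $\lambda\in\mathbb D$; one can take $B(0)=0$, i.e. $H_+=N(0)$, $H_-=N(0)^{\perp_s}$. For every such representation of $N$ there is a boundary quadruple $(H_\pm,\Gamma_\pm)$ for $\mathfrak A^{\perp_s}$, i.e. continuous linear maps $\Gamma_\pm:\mathfrak A^{\perp_s}\to H_\pm$ such that $(\Gamma_+,\Gamma_-)$ induces a symplectic isomorphism of $\mathfrak A^{\perp_s}/\mathfrak A$ onto $H_+\oplus H_-$, whose contractive Weyl function is exactly $B$: $(\Gamma_+,\Gamma_-)N_\lambda=\{(x,B(\lambda)x):x\in H_+\}$ for $\lambda\in\mathbb D_+$ and $(\Gamma_+,\Gamma_-)N_\lambda=\{(B(\bar\lambda)^*x,x):x\in H_-\}$ for $\lambda\in\mathbb D_-$. -/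

import Mathlib

universe u v w

open Complex Filter Topology
open scoped ComplexConjugate Complex.UnitDisc

noncomputable section

/-! ### Strong symplectic spaces -/

section Symplectic

variable {H : Type*} [SeminormedAddCommGroup H] [NormedSpace ℂ H]

/-- `ω` (linear in the first, conjugate-linear in the second variable) is a strong symplectic
structure: continuous, skew-Hermitian, non-degenerate, and `x ↦ ω(·, x)` is onto the dual. -/
structure IsStrongSymplectic (ω : H →ₗ[ℂ] H →ₗ⋆[ℂ] ℂ) : Prop where
  continuous : Continuous fun p : H × H => ω p.1 p.2
  skew : ∀ x y, ω y x = -conj (ω x y)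
  nondegenerate : ∀ x, (∀ y, ω x y = 0) → x = 0
  surjective : ∀ φ : H →L[ℂ] ℂ, ∃ x, ∀ y, φ y = ω y x

/-- The symplectic orthogonal complement. -/
def sympOrth (ω : H →ₗ[ℂ] H →ₗ⋆[ℂ] ℂ) (L : Submodule ℂ H) : Submodule ℂ H where
  carrier := {x | ∀ y ∈ L, ω x y = 0}
  add_mem' {a b} ha hb y hy := by simp [ha y hy, hb y hy]
  zero_mem' y _ := by simp
  smul_mem' c x hx y hy := by simp [hx y hy]

/-- Isotropic subspaces (closed by definition). -/
def IsIsotropic (ω : H →ₗ[ℂ] H →ₗ⋆[ℂ] ℂ) (L : Submodule ℂ H) : Prop :=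
  IsClosed (L : Set H) ∧ ∀ x ∈ L, ∀ y ∈ L, ω x y = 0

/-- `-i[x,x] > 0` for all nonzero `x ∈ L`. -/
def IsPositiveDefinite (ω : H →ₗ[ℂ] H →ₗ⋆[ℂ] ℂ) (L : Submodule ℂ H) : Prop :=
  ∀ x ∈ L, x ≠ 0 → 0 < (-I * ω x x).re

/-- The set `W₊(H)` of maximal completely positive-definite subspaces. -/
def WPlus (ω : H →ₗ[ℂ] H →ₗ⋆[ℂ] ℂ) : Set (Submodule ℂ H) :=
  {L | IsClosed (L : Set H) ∧ IsPositiveDefinite ω L ∧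
    (∀ M : Submodule ℂ H, IsPositiveDefinite ω M → L ≤ M → M = L) ∧
    ∃ c : ℝ, 0 < c ∧ ∀ x ∈ L, c * ‖x‖ ^ 2 ≤ (-I * ω x x).re}

/-- A Nevanlinna disc: a holomorphic map from the unit disc to `W₊(H)`. The complex structure of
`W₊(H)` is given by its global charts: a polarization `L ∈ W₊(H)` identifies `W = {x + B x | x ∈ L}`
with the operator `B : L → L^{⊥ₛ}`; holomorphy is required in each of these charts. -/
def IsNevanlinnaDisc (ω : H →ₗ[ℂ] H →ₗ⋆[ℂ] ℂ) (N : 𝔻 → Submodule ℂ H) : Prop :=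
  (∀ z, N z ∈ WPlus ω) ∧
  ∀ L ∈ WPlus ω, ∃ B : ℂ → (L →L[ℂ] sympOrth ω L),
    DifferentiableOn ℂ B (Metric.ball 0 1) ∧
    ∀ z : 𝔻, (N z : Set H) = {h | ∃ x : L, h = (x : H) + (B z x : H)}

/-- The quotient `A^{⊥ₛ} / A`. -/
abbrev SympQuot (ω : H →ₗ[ℂ] H →ₗ⋆[ℂ] ℂ) (A : Submodule ℂ H) : Type _ :=
  sympOrth ω A ⧸ A.submoduleOf (sympOrth ω A)

lemma quotForm_wellDefined {ω : H →ₗ[ℂ] H →ₗ⋆[ℂ] ℂ} (hω : IsStrongSymplectic ω)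
    (A : Submodule ℂ H) (a₁ b₁ a₂ b₂ : sympOrth ω A)
    (ha : (A.submoduleOf (sympOrth ω A)).quotientRel a₁ a₂)
    (hb : (A.submoduleOf (sympOrth ω A)).quotientRel b₁ b₂) :
    ω (a₁ : H) (b₁ : H) = ω (a₂ : H) (b₂ : H) := by
  rw [Submodule.quotientRel_def] at ha hb
  have ha' : ((a₁ : H) - a₂) ∈ A := ha
  have hb' : ((b₁ : H) - b₂) ∈ A := hb
  have h1 : ω ((a₁ : H) - a₂) (b₁ : H) = 0 := by
    rw [hω.skew, b₁.2 _ ha']; simp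
  have h2 : ω (a₂ : H) ((b₁ : H) - b₂) = 0 := a₂.2 _ hb'
  rw [map_sub, LinearMap.sub_apply, sub_eq_zero] at h1
  rw [map_sub, sub_eq_zero] at h2
  rw [h1, h2]

/-- The quotient symplectic structure `[[x],[y]]_q = [x,y]` on `A^{⊥ₛ} / A`. -/
def quotForm {ω : H →ₗ[ℂ] H →ₗ⋆[ℂ] ℂ} (hω : IsStrongSymplectic ω) (A : Submodule ℂ H) :
    SympQuot ω A →ₗ[ℂ] SympQuot ω A →ₗ⋆[ℂ] ℂ :=
  LinearMap.mk₂'ₛₗ (RingHom.id ℂ) (starRingEnd ℂ)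
    (fun a b => Quotient.liftOn₂ a b
      (fun x y : sympOrth ω A => ω (x : H) (y : H)) (quotForm_wellDefined hω A))
    (by rintro ⟨a⟩ ⟨b⟩ ⟨c⟩; exact congrArg (fun f => f (c : H)) (map_add ω (a : H) (b : H)))
    (by rintro c ⟨a⟩ ⟨b⟩; exact congrArg (fun f => f (b : H)) (map_smul ω c (a : H)))
    (by rintro ⟨a⟩ ⟨b⟩ ⟨c⟩; exact map_add (ω (a : H)) (b : H) (c : H))
    (by rintro c ⟨a⟩ ⟨b⟩; exact LinearMap.map_smulₛₗ (ω (a : H)) c (b : H))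

/-- Symplectic isomorphisms: topological linear isomorphisms preserving the forms. -/
def IsSymplecticIso {H' : Type*} [SeminormedAddCommGroup H'] [NormedSpace ℂ H']
    (ω : H →ₗ[ℂ] H →ₗ⋆[ℂ] ℂ) (ω' : H' →ₗ[ℂ] H' →ₗ⋆[ℂ] ℂ) (Φ : H ≃L[ℂ] H') : Prop :=
  ∀ x y, ω' (Φ x) (Φ y) = ω x y

/-- Congruence of Nevanlinna discs. -/
def CongruentDiscs {H' : Type*} [SeminormedAddCommGroup H'] [NormedSpace ℂ H']
    (ω : H →ₗ[ℂ] H →ₗ⋆[ℂ] ℂ) (N : 𝔻 → Submodule ℂ H)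
    (ω' : H' →ₗ[ℂ] H' →ₗ⋆[ℂ] ℂ) (N' : 𝔻 → Submodule ℂ H') : Prop :=
  ∃ Φ : H ≃L[ℂ] H', IsSymplecticIso ω ω' Φ ∧ ∀ z, Φ '' (N z : Set H) = (N' z : Set H')

end Symplectic

/-! ### The standard strong symplectic space `H₊ ⊕ H₋` -/

section Standard

variable (Hp Hm : Type*) [NormedAddCommGroup Hp] [InnerProductSpace ℂ Hp]
  [NormedAddCommGroup Hm] [InnerProductSpace ℂ Hm]

/-- `[x,y]_st = i (x₁,y₁) - i (x₂,y₂)`; note `(a,b) = inner ℂ b a`, as Mathlib's inner product is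
conjugate-linear in its first variable. -/
def stdForm : WithLp 2 (Hp × Hm) →ₗ[ℂ] WithLp 2 (Hp × Hm) →ₗ⋆[ℂ] ℂ :=
  LinearMap.mk₂'ₛₗ (RingHom.id ℂ) (starRingEnd ℂ)
    (fun x y => I * inner ℂ y.fst x.fst - I * inner ℂ y.snd x.snd)
    (by intros; simp only [WithLp.add_fst, WithLp.add_snd, inner_add_right]; ring)
    (by
      intros
      simp only [WithLp.smul_fst, WithLp.smul_snd, inner_smul_right, RingHom.id_apply, smul_eq_mul]
      ring)
    (by intros; simp only [WithLp.add_fst, WithLp.add_snd, inner_add_left]; ring)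
    (by
      intros
      simp only [WithLp.smul_fst, WithLp.smul_snd, inner_smul_left, smul_eq_mul]
      ring)

lemma stdForm_apply (x y : WithLp 2 (Hp × Hm)) :
    stdForm Hp Hm x y = I * inner ℂ y.fst x.fst - I * inner ℂ y.snd x.snd := rfl

theorem stdForm_isStrongSymplectic [CompleteSpace Hp] [CompleteSpace Hm] :
    IsStrongSymplectic (stdForm Hp Hm) where
  continuous := by
    simp only [stdForm_apply]
    have h1 : Continuous fun x : WithLp 2 (Hp × Hm) => x.fst := (WithLp.fstL 2 ℂ Hp Hm).continuous
    have h2 : Continuous fun x : WithLp 2 (Hp × Hm) => x.snd := (WithLp.sndL 2 ℂ Hp Hm).continuous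
    fun_prop
  skew x y := by
    simp only [stdForm_apply, map_sub, map_mul, conj_I, inner_conj_symm]
    ring
  nondegenerate x h := by
    have h1 := h (WithLp.toLp 2 (x.fst, 0))
    have h2 := h (WithLp.toLp 2 (0, x.snd))
    simp only [stdForm_apply, WithLp.toLp_fst, WithLp.toLp_snd, inner_zero_left, mul_zero, sub_zero,
      zero_sub, neg_eq_zero, mul_eq_zero, I_ne_zero, false_or, inner_self_eq_zero] at h1 h2
    apply WithLp.ofLp_injective 2
    exact Prod.ext h1 h2
  surjective φ := by
    obtain ⟨y, hy⟩ := (InnerProductSpace.toDual ℂ (WithLp 2 (Hp × Hm))).surjective φ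
    refine ⟨WithLp.toLp 2 (I • y.fst, -(I • y.snd)), fun x => ?_⟩
    rw [← hy, InnerProductSpace.toDual_apply_apply, WithLp.prod_inner_apply, stdForm_apply]
    simp only [WithLp.toLp_fst, WithLp.toLp_snd, WithLp.ofLp_fst, WithLp.ofLp_snd, inner_neg_left,
      inner_smul_left, conj_I]
    ring_nf
    simp

variable {Hp Hm} in
/-- `{(x, B x) | x ∈ H₊}`. -/
def graphOf (B : Hp →L[ℂ] Hm) : Set (WithLp 2 (Hp × Hm)) :=
  {a | ∃ x : Hp, a = WithLp.toLp 2 (x, B x)}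

variable {Hp Hm} in
/-- `{(C x, x) | x ∈ H₋}`. -/
def cographOf (C : Hm →L[ℂ] Hp) : Set (WithLp 2 (Hp × Hm)) :=
  {a | ∃ x : Hm, a = WithLp.toLp 2 (C x, x)}

variable {Hp Hm} in
/-- Operator-valued Schur functions with `‖B(λ)‖ < 1` pointwise. Only the values on the open unit
disc matter. -/
def IsStrictSchur (B : ℂ → (Hp →L[ℂ] Hm)) : Prop :=
  DifferentiableOn ℂ B (Metric.ball 0 1) ∧ ∀ z : 𝔻, ‖B z‖ < 1

variable {Hp Hm} in
/-- `Ψ` identifies `H` with the standard space `H₊ ⊕ H₋` in such a way that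
`N(λ) = {(x, B(λ)x) | x ∈ H₊}`. -/
def IsStandardRepresentation {H : Type*} [SeminormedAddCommGroup H] [NormedSpace ℂ H]
    (ω : H →ₗ[ℂ] H →ₗ⋆[ℂ] ℂ) (N : 𝔻 → Submodule ℂ H)
    (Ψ : H ≃L[ℂ] WithLp 2 (Hp × Hm)) (B : ℂ → (Hp →L[ℂ] Hm)) : Prop :=
  IsSymplecticIso ω (stdForm Hp Hm) Ψ ∧ IsStrictSchur B ∧
    ∀ z : 𝔻, Ψ '' (N z : Set H) = graphOf (B z)

end Standard

/-! ### The two discs and the Weyl curve -/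

/-- `𝔻₊ ∪ 𝔻₋`: the point `(true, z)` lies in `𝔻₊` and `(false, z)` in `𝔻₋`. -/
abbrev TwoDiscs : Type := Bool × 𝔻

/-- `λ ↦ λ̄`, with the result in the other copy of the disc. -/
def TwoDiscs.conj (p : TwoDiscs) : TwoDiscs := (!p.1, star p.2)

/-- The extension `𝒩` of `N` to `𝔻₊ ∪ 𝔻₋` by `𝒩(λ) = N(λ̄)^{⊥ₛ}` on `𝔻₋`. -/
def extendDisc {H : Type*} [SeminormedAddCommGroup H] [NormedSpace ℂ H]
    (ω : H →ₗ[ℂ] H →ₗ⋆[ℂ] ℂ) (N : 𝔻 → Submodule ℂ H) : TwoDiscs → Submodule ℂ H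
  | (true, z) => N z
  | (false, z) => sympOrth ω (N (star z))

section Weyl

variable (E : Type*) [NormedAddCommGroup E] [InnerProductSpace ℂ E]

/-- The universal Weyl curve in `E ⊕ E`: `{(x, λx)}` on `𝔻₊` and `{(λx, x)}` on `𝔻₋`. -/
def universalWeyl : TwoDiscs → Submodule ℂ (WithLp 2 (E × E))
  | (true, z) =>
    { carrier := {a | a.snd = (z : ℂ) • a.fst}
      add_mem' := by intro a b ha hb; simp_all
      zero_mem' := by simp
      smul_mem' := by intro c a ha; simp_all [smul_comm c] }
  | (false, z) =>
    { carrier := {a | a.fst = (z : ℂ) • a.snd}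
      add_mem' := by intro a b ha hb; simp_all
      zero_mem' := by simp
      smul_mem' := by intro c a ha; simp_all [smul_comm c] }

variable {E}

/-- `N_λ = W_λ ∩ A^{⊥ₛ}`, as a subspace of `A^{⊥ₛ}`. -/
def weylDefect (A : Submodule ℂ (WithLp 2 (E × E))) (p : TwoDiscs) :
    Submodule ℂ (sympOrth (stdForm E E) A) :=
  (universalWeyl E p).submoduleOf (sympOrth (stdForm E E) A)

/-- The (two-branched) Weyl curve of `A`: the image of `N_λ` in `A^{⊥ₛ} / A`. -/
def weylCurve (A : Submodule ℂ (WithLp 2 (E × E))) (p : TwoDiscs) :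
    Submodule ℂ (SympQuot (stdForm E E) A) :=
  (weylDefect A p).map (A.submoduleOf (sympOrth (stdForm E E) A)).mkQ

variable {Hp Hm : Type*} [NormedAddCommGroup Hp] [InnerProductSpace ℂ Hp]
  [NormedAddCommGroup Hm] [InnerProductSpace ℂ Hm]

/-- `(H₊, H₋, Γ₊, Γ₋)` is a boundary quadruple for `A^{⊥ₛ}`: `(Γ₊, Γ₋)` is induced by a symplectic
isomorphism of `A^{⊥ₛ} / A` with the standard space `H₊ ⊕ H₋`. -/
def IsBoundaryQuadruple [CompleteSpace E] (A : Submodule ℂ (WithLp 2 (E × E)))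
    (Γp : sympOrth (stdForm E E) A →L[ℂ] Hp) (Γm : sympOrth (stdForm E E) A →L[ℂ] Hm) : Prop :=
  ∃ Φ : SympQuot (stdForm E E) A ≃L[ℂ] WithLp 2 (Hp × Hm),
    IsSymplecticIso (quotForm (stdForm_isStrongSymplectic E E) A) (stdForm Hp Hm) Φ ∧
    ∀ a, Φ ((A.submoduleOf (sympOrth (stdForm E E) A)).mkQ a) = WithLp.toLp 2 (Γp a, Γm a)

/-- `B` is the contractive Weyl function of `A` with respect to `(H₊, H₋, Γ₊, Γ₋)`: it is a Schur
function with `‖B(λ)‖ < 1`, the boundary values of `N_λ` are `{(x, B(λ)x)}` for `λ ∈ 𝔻₊` and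
`{(B(λ̄)* x, x)}` for `λ ∈ 𝔻₋`. -/
def IsContractiveWeylFunction [CompleteSpace Hp] [CompleteSpace Hm]
    (A : Submodule ℂ (WithLp 2 (E × E)))
    (Γp : sympOrth (stdForm E E) A →L[ℂ] Hp) (Γm : sympOrth (stdForm E E) A →L[ℂ] Hm)
    (B : ℂ → (Hp →L[ℂ] Hm)) : Prop :=
  IsStrictSchur B ∧
  (∀ z : 𝔻, (fun a => WithLp.toLp 2 (Γp a, Γm a)) ''
    (weylDefect A (true, z) : Set (sympOrth (stdForm E E) A)) = graphOf (B z)) ∧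
  (∀ z : 𝔻, (fun a => WithLp.toLp 2 (Γp a, Γm a)) ''
    (weylDefect A (false, z) : Set (sympOrth (stdForm E E) A)) =
      cographOf (ContinuousLinearMap.adjoint (B (conj (z : ℂ)))))

end Weyl

/-! ### The reproducing kernel of a Nevanlinna disc -/

section Kernel

variable {H : Type*} [SeminormedAddCommGroup H] [NormedSpace ℂ H]
  (ω : H →ₗ[ℂ] H →ₗ⋆[ℂ] ℂ) (N : 𝔻 → Submodule ℂ H)

/-- The Hermitian structure on the fibre `E_λ = 𝒩(λ)`: `-i[x,y]` on `𝔻₊`, `i[x,y]` on `𝔻₋`. -/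
def fibreHerm (p : TwoDiscs) (x y : H) : ℂ :=
  if p.1 then -I * ω x y else I * ω x y

/-- The fibre `F†_λ = E_{λ̄}`. -/
def dualFibre (p : TwoDiscs) : Submodule ℂ H := extendDisc ω N p.conj

open Classical in
/-- The projection `𝒫_λ` of `H` onto `F†_λ` along `F†_{λ̄}` (these subspaces are complementary for
every Nevanlinna disc; otherwise the value is `0`). -/
def fibreProj (p : TwoDiscs) : H →ₗ[ℂ] dualFibre ω N p :=
  if h : IsCompl (dualFibre ω N p) (dualFibre ω N p.conj) then
    Submodule.projectionOnto _ _ h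
  else 0

/-- `((𝒬(λ,μ) x, η)) = (𝒫_λ x, η)_λ`, where the Hermitian structure on `F†_λ` is that of
`E_{λ̄}`. -/
def kernelQ (p q : TwoDiscs) (x : dualFibre ω N q) (η : dualFibre ω N p) : ℂ :=
  fibreHerm ω p.conj (fibreProj ω N p (x : H) : H) (η : H)

open Classical in
/-- The pairing `((K(λ,μ) x, η))` for `x ∈ F†_μ`, `η ∈ F†_λ`. In the case `λ = μ̄`, the value of
`K(μ̄,μ) x` is the limit of `K(λ',μ) x ∈ F_{λ'}` as `λ' → μ̄`, computed against the local continuous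
section `λ' ↦ 𝒫_{λ'} η` of `F†` through `η`. -/
def kernelPairing (p q : TwoDiscs) (x : dualFibre ω N q) (η : dualFibre ω N p) : ℂ :=
  if p.1 = q.1 then kernelQ ω N p q x η / (1 - (p.2 : ℂ) * conj (q.2 : ℂ))
  else if p.2 = star q.2 then
    limUnder (𝓝[≠] p.2) fun z : 𝔻 =>
      -kernelQ ω N (p.1, z) q x (fibreProj ω N (p.1, z) (η : H)) / ((z : ℂ) - conj (q.2 : ℂ))
  else -kernelQ ω N p q x η / ((p.2 : ℂ) - conj (q.2 : ℂ))

/-- The total space of the bundle `F†`. A section `s` of the conjugate-linear dual bundle `F` is the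
same thing as the function `(λ, η) ↦ ((s(λ), η))` on this space, conjugate-linear on each fibre. -/
abbrev TotalSpace : Type _ := Σ p : TwoDiscs, dualFibre ω N p

/-- The kernel `K` on `F`, as a scalar kernel on the total space of `F†`:
its value at `((λ, η), (μ, x))` is (multiplication by) `((K(λ,μ) x, η))`. -/
def sectionKernel : Matrix (TotalSpace ω N) (TotalSpace ω N) (ℂ →L[ℂ] ℂ) :=
  Matrix.of fun s t => kernelPairing ω N s.1 t.1 t.2 s.2 • (1 : ℂ →L[ℂ] ℂ)

/-- The reproducing kernel Hilbert space `𝔥` generated by `K`; for `f ∈ 𝔥`, the pairing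
`((f(λ), η))` is `f ⟨λ, η⟩`. -/
abbrev ModelSpace [Fact (sectionKernel ω N).PosSemidef] : Type _ :=
  RKHS.OfKernel (sectionKernel ω N)

/-- `𝔄 = {(f,g) | g(λ) = λ f(λ) on 𝔻₊, f(λ) = λ g(λ) on 𝔻₋}`. -/
def modelRelation [Fact (sectionKernel ω N).PosSemidef] :
    Submodule ℂ (WithLp 2 (ModelSpace ω N × ModelSpace ω N)) where
  carrier := {a |
    (∀ (z : 𝔻) (η : dualFibre ω N (true, z)),
      a.snd ⟨(true, z), η⟩ = (z : ℂ) * a.fst ⟨(true, z), η⟩) ∧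
    (∀ (z : 𝔻) (η : dualFibre ω N (false, z)),
      a.fst ⟨(false, z), η⟩ = (z : ℂ) * a.snd ⟨(false, z), η⟩)}
  add_mem' {a b} ha hb := by
    refine ⟨fun z η => ?_, fun z η => ?_⟩
    · have h1 := ha.1 z η
      have h2 := hb.1 z η
      simp only [WithLp.add_fst, WithLp.add_snd, RKHS.coe_add, Pi.add_apply, h1, h2, mul_add]
    · have h1 := ha.2 z η
      have h2 := hb.2 z η
      simp only [WithLp.add_fst, WithLp.add_snd, RKHS.coe_add, Pi.add_apply, h1, h2, mul_add]
  zero_mem' := by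
    refine ⟨fun z η => ?_, fun z η => ?_⟩ <;> simp
  smul_mem' c a ha := by
    refine ⟨fun z η => ?_, fun z η => ?_⟩
    · have h1 := ha.1 z η
      simp only [WithLp.smul_fst, WithLp.smul_snd, RKHS.coe_smul, Pi.smul_apply, h1, smul_eq_mul]
      ring
    · have h1 := ha.2 z η
      simp only [WithLp.smul_fst, WithLp.smul_snd, RKHS.coe_smul, Pi.smul_apply, h1, smul_eq_mul]
      ring

/-- The standard strong symplectic structure on `ℍ = 𝔥 ⊕ 𝔥`. -/
abbrev modelForm [Fact (sectionKernel ω N).PosSemidef] :=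
  stdForm (ModelSpace ω N) (ModelSpace ω N)

/-- The quotient strong symplectic structure on `𝔄^{⊥ₛ} / 𝔄`. -/
abbrev modelQuotForm [Fact (sectionKernel ω N).PosSemidef] :=
  quotForm (stdForm_isStrongSymplectic (ModelSpace ω N) (ModelSpace ω N)) (modelRelation ω N)

end Kernel

end

/-! Polarizing `H` by `N(0)` turns `H` into a standard space H₊ ⊕ H₋ and `N` into the graphs of a
strictly contractive holomorphic B with B(0) = 0. In these coordinates K is the two-sided de
Branges–Rovnyak kernel of B (`IsStandardRepresentation.kernelPairing_eq`). If B is holomorphic up to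
the circle, this kernel is a weighted circle average of the positive forms of the operator matrices
(1, -B*; -B, 1), hence positive; the dilations B(rλ), r → 1, give the general case
(`re_schurKernel_sum_nonneg`).

For the model, a vector x of F†_λ with kernel function k yields the defect vector (λ̄k, k) over 𝔻₊
or (k, λ̄k) over 𝔻₋. The denominators of K are exactly those for which the standard form of two
defect vectors equals the form of the underlying vectors of `H` (`modelForm_defectVector`), and by
the reproducing property 𝔄 is the symplectic complement of the defect vectors. As B(0) = 0, the
defect vectors over the two points 0 span a symplectic copy of H₊ ⊕ H₋, the range of an embedding T.
Every other defect vector differs from one in this range by an element of 𝔄. Hence 𝔄^{⊥ₛ} = ran T +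
𝔄, and the quotient is `H` (`IsModelEmbedding.exists_quotient_equiv`).

Isotropy of 𝔄 is not formal. The differences just mentioned lie in 𝔄 and are symplectically
orthogonal to 𝔄, and the closures of their first and of their second components contain those of all
of 𝔄; this forces ‖f‖ = ‖g‖ for (f, g) in 𝔄 (`IsModelEmbedding.isIsotropic`).

Since defect vectors belong to the defect spaces N_λ, the Weyl curve, carried to `H`, contains 𝒩(λ).
Equality follows on 𝔻₊ from the maximality of `N(λ)`, on 𝔻₋ from the sign of the form. The remaining
claims are transported along the isomorphism. -/

/-! ### Hermitian forms on Hilbert spaces -/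

section HermitianForms

variable {E : Type*} [NormedAddCommGroup E] [InnerProductSpace ℂ E] [CompleteSpace E]

/-- A continuous Hermitian form is represented by a bounded self-adjoint operator. -/
lemma exists_isSelfAdjoint_of_hermitian (h : E →ₗ[ℂ] E →ₗ⋆[ℂ] ℂ)
    (hc : Continuous fun p : E × E => h p.1 p.2) (hs : ∀ x y, h y x = conj (h x y)) :
    ∃ A : E →L[ℂ] E, IsSelfAdjoint A ∧ ∀ x y, inner ℂ y (A x) = h x y := by
  let φ (x : E) : E →L[ℂ] ℂ :=
    { toFun := fun y => h y x
      map_add' := by simp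
      map_smul' := by simp
      cont := hc.comp (by fun_prop : Continuous fun y : E => (y, x)) }
  have hφ (x y : E) : inner ℂ ((InnerProductSpace.toDual ℂ E).symm (φ x)) y = h y x := by
    rw [InnerProductSpace.toDual_symm_apply]; rfl
  have hφ' (x y : E) : inner ℂ y ((InnerProductSpace.toDual ℂ E).symm (φ x)) = h x y := by
    rw [← inner_conj_symm, hφ, ← hs]
  let A : E →ₗ[ℂ] E :=
    { toFun := fun x => (InnerProductSpace.toDual ℂ E).symm (φ x)
      map_add' := fun x y => ext_inner_left ℂ fun v => by simp [inner_add_right, hφ']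
      map_smul' := fun c x => ext_inner_left ℂ fun v => by simp [inner_smul_right, hφ'] }
  -- Boundedness will be Hellinger–Toeplitz: a symmetric operator defined everywhere is continuous.
  have hA : A.IsSymmetric := fun x y => (hφ x y).trans (hφ' y x).symm
  refine ⟨⟨A, hA.continuous⟩, ?_, hφ'⟩
  rw [ContinuousLinearMap.isSelfAdjoint_iff_isSymmetric]
  exact hA

/-- A positive Hermitian form whose Gram operator is invertible is the pull-back of the inner
product along an automorphism. -/
lemma exists_equiv_inner_eq {A : E →L[ℂ] E} (hA : IsSelfAdjoint A) (hu : IsUnit A)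
    (hp : ∀ x, 0 ≤ (inner ℂ x (A x)).re) :
    ∃ S : E ≃L[ℂ] E, ∀ x y, inner ℂ (S y) (S x) = inner ℂ y (A x) := by
  have hA0 : 0 ≤ A := by
    rw [ContinuousLinearMap.nonneg_iff_isPositive, ContinuousLinearMap.isPositive_def']
    refine ⟨hA, fun x => ?_⟩
    have := hp x
    rw [← inner_conj_symm, conj_re] at this
    exact this
  obtain ⟨S, hS⟩ := (CFC.isUnit_sqrt_iff A hA0).2 hu
  refine ⟨ContinuousLinearEquiv.unitsEquiv ℂ E S, fun x y => ?_⟩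
  have h1 : IsSelfAdjoint (CFC.sqrt A) := (CFC.sqrt_nonneg A).isSelfAdjoint
  rw [ContinuousLinearMap.isSelfAdjoint_iff_isSymmetric] at h1
  have h2 : CFC.sqrt A (CFC.sqrt A x) = A x :=
    congrArg (fun T : E →L[ℂ] E => T x) (CFC.sqrt_mul_sqrt_self A hA0)
  have h3 (x : E) : ContinuousLinearEquiv.unitsEquiv ℂ E S x = CFC.sqrt A x := by
    rw [← hS]; rfl
  rw [h3, h3, ← h2]
  exact h1 y _

end HermitianForms

/-! ### Strong symplectic spaces and maximal positive subspaces -/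

section General

variable {H : Type*} [SeminormedAddCommGroup H] [NormedSpace ℂ H] {ω : H →ₗ[ℂ] H →ₗ⋆[ℂ] ℂ}

lemma mem_sympOrth {L : Submodule ℂ H} {x : H} : x ∈ sympOrth ω L ↔ ∀ y ∈ L, ω x y = 0 := Iff.rfl

namespace IsStrongSymplectic

lemma eq_zero_comm (hω : IsStrongSymplectic ω) {x y : H} : ω x y = 0 ↔ ω y x = 0 := by
  rw [hω.skew x y]; simp

lemma neg_I_mul_self (hω : IsStrongSymplectic ω) (x : H) :
    -I * ω x x = ((-I * ω x x).re : ℂ) := by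
  have h := congrArg Complex.re (hω.skew x x)
  simp only [neg_re, conj_re] at h
  have h0 : (ω x x).re = 0 := by linarith
  apply Complex.ext <;> simp [h0]

lemma isClosed_sympOrth (hω : IsStrongSymplectic ω) (L : Submodule ℂ H) :
    IsClosed (sympOrth ω L : Set H) := by
  have : (sympOrth ω L : Set H) = ⋂ y ∈ L, {x | ω x y = 0} := by
    ext x; simp [mem_sympOrth]
  rw [this]
  refine isClosed_biInter fun y _ => isClosed_eq ?_ continuous_const
  exact hω.continuous.comp (by fun_prop : Continuous fun x : H => (x, y))

lemma disjoint_of_isPositiveDefinite {L : Submodule ℂ H} (hL : IsPositiveDefinite ω L) :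
    Disjoint L (sympOrth ω L) := by
  rw [Submodule.disjoint_def]
  intro x hx hx'
  by_contra h
  have := hL x hx h
  rw [hx' x hx] at this
  simp at this

/-- The form `-i[x,x]` is non-positive on the orthogonal complement of a maximal positive
subspace. -/
lemma re_nonpos_of_maximal (hω : IsStrongSymplectic ω) {L : Submodule ℂ H}
    (hL : IsPositiveDefinite ω L)
    (hmax : ∀ M : Submodule ℂ H, IsPositiveDefinite ω M → L ≤ M → M = L)
    {x : H} (hx : x ∈ sympOrth ω L) : (-I * ω x x).re ≤ 0 := by
  by_contra! h
  -- Adjoining to L a positive vector x orthogonal to L keeps it positive; maximality then puts x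
  -- into L, where x would be orthogonal to itself.
  have hM : IsPositiveDefinite ω (L ⊔ Submodule.span ℂ {x}) := by
    intro z hz hz0
    obtain ⟨y, hy, w, hw, rfl⟩ := Submodule.mem_sup.1 hz
    obtain ⟨c, rfl⟩ := Submodule.mem_span_singleton.1 hw
    have h1 : ω x y = 0 := hx y hy
    have h2 : ω y x = 0 := hω.eq_zero_comm.1 h1
    have h3 : (-I * ω (y + c • x) (y + c • x)).re
        = (-I * ω y y).re + ‖c‖ ^ 2 * (-I * ω x x).re := by
      have : -I * ω (y + c • x) (y + c • x) = -I * ω y y + (c * conj c) * (-I * ω x x) := by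
        simp [h1, h2]; ring
      rw [this, Complex.mul_conj, hω.neg_I_mul_self x, add_re, ← ofReal_mul, ofReal_re,
        Complex.normSq_eq_norm_sq, ofReal_re]
    rw [h3]
    by_cases hy0 : y = 0
    · have hc : c ≠ 0 := by rintro rfl; simp [hy0] at hz0
      have : 0 < ‖c‖ := norm_pos_iff.2 hc
      simp only [hy0, map_zero, mul_zero, zero_re, zero_add]
      positivity
    · have := hL y hy hy0
      positivity
  have hxL : x ∈ L := by
    rw [← hmax _ hM le_sup_left]
    exact Submodule.mem_sup_right (Submodule.mem_span_singleton_self x)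
  rw [hx x hxL] at h
  simp at h

end IsStrongSymplectic

/-- A graph in the standard space that corresponds to a uniformly positive subspace is the graph of
a strict contraction. -/
lemma norm_lt_one_of_graph_mem_WPlus {Hp Hm : Type*} [NormedAddCommGroup Hp]
    [InnerProductSpace ℂ Hp] [NormedAddCommGroup Hm] [InnerProductSpace ℂ Hm]
    {Ψ : H ≃L[ℂ] WithLp 2 (Hp × Hm)} (hΨ : IsSymplecticIso ω (stdForm Hp Hm) Ψ)
    {L : Submodule ℂ H} (hL : L ∈ WPlus ω) {B : Hp →L[ℂ] Hm} (hB : Ψ '' (L : Set H) = graphOf B) :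
    ‖B‖ < 1 := by
  obtain ⟨-, -, -, c, hc, h⟩ := hL
  have key (x : Hp) :
      c * ‖Ψ.symm (WithLp.toLp 2 (x, B x))‖ ^ 2 ≤ ‖x‖ ^ 2 - ‖B x‖ ^ 2 := by
    have hx : WithLp.toLp 2 (x, B x) ∈ Ψ '' (L : Set H) := hB ▸ ⟨x, rfl⟩
    obtain ⟨a, ha, hax⟩ := hx
    have h1 := h a ha
    rw [← hΨ a a, hax, stdForm_apply] at h1
    rw [← hax, Ψ.symm_apply_apply]
    refine h1.trans_eq ?_
    simp only [inner_self_eq_norm_sq_to_K]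
    have : -I * (I * ((‖x‖ : ℂ) ^ 2) - I * (‖B x‖ : ℂ) ^ 2) =
        ((‖x‖ ^ 2 - ‖B x‖ ^ 2 : ℝ) : ℂ) := by
      push_cast
      linear_combination (-(‖x‖ : ℂ) ^ 2 + (‖B x‖ : ℂ) ^ 2) * I_mul_I
    exact (congrArg Complex.re this).trans (ofReal_re _)
  set K := ‖(Ψ : H →L[ℂ] WithLp 2 (Hp × Hm))‖
  have hK (x : Hp) : ‖x‖ ≤ K * ‖Ψ.symm (WithLp.toLp 2 (x, B x))‖ := by
    have h1 := (Ψ : H →L[ℂ] WithLp 2 (Hp × Hm)).le_opNorm (Ψ.symm (WithLp.toLp 2 (x, B x)))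
    simp only [ContinuousLinearEquiv.coe_coe, ContinuousLinearEquiv.apply_symm_apply] at h1
    exact (WithLp.norm_fst_le (x := WithLp.toLp 2 (x, B x))).trans h1
  have hK0 : 0 ≤ K := by positivity
  -- Since ‖x‖ ≤ K‖a‖ for the preimage a of (x, Bx), uniform positivity gives ‖x‖² - ‖Bx‖² ≥ δ‖x‖².
  -- The summand 1 keeps the denominator positive.
  set δ := c / (K + 1) ^ 2
  have hδ : 0 < δ := by positivity
  have hδx (x : Hp) : ‖B x‖ ^ 2 ≤ (1 - δ) * ‖x‖ ^ 2 := by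
    have h2 : ‖x‖ ^ 2 ≤ (K + 1) ^ 2 * ‖Ψ.symm (WithLp.toLp 2 (x, B x))‖ ^ 2 := by
      rw [← mul_pow]
      have : K * ‖Ψ.symm (WithLp.toLp 2 (x, B x))‖ ≤ (K + 1) * ‖Ψ.symm (WithLp.toLp 2 (x, B x))‖ := by
        gcongr; linarith
      gcongr
      exact (hK x).trans this
    have h3 : δ * ‖x‖ ^ 2 ≤ c * ‖Ψ.symm (WithLp.toLp 2 (x, B x))‖ ^ 2 := by
      rw [div_mul_eq_mul_div, div_le_iff₀ (by positivity)]
      calc _ ≤ c * ((K + 1) ^ 2 * ‖Ψ.symm (WithLp.toLp 2 (x, B x))‖ ^ 2) := by gcongr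
        _ = _ := by ring
    linarith [key x]
  -- Nothing prevents δ > 1 when H₊ is trivial, hence the maximum.
  have hs : Real.sqrt (max 0 (1 - δ)) < 1 := by
    rw [Real.sqrt_lt' one_pos]
    exact max_lt (by norm_num) (by linarith)
  refine lt_of_le_of_lt (B.opNorm_le_bound (Real.sqrt_nonneg _) fun x => ?_) hs
  refine Real.le_sqrt_of_sq_le ?_ |>.trans_eq (Real.sqrt_mul_self (by positivity))
  rw [mul_mul_mul_comm, Real.mul_self_sqrt (le_max_left _ _), ← sq]
  exact (hδx x).trans (by gcongr; exact le_max_right _ _)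

end General

/-! ### Polarizations of a strong symplectic Hilbert space. -/

section Hilbert

variable {H : Type*} [NormedAddCommGroup H] [InnerProductSpace ℂ H] [CompleteSpace H]
  {ω : H →ₗ[ℂ] H →ₗ⋆[ℂ] ℂ}

namespace IsStrongSymplectic

/-- The Hermitian form `c [x,y]`, `c` imaginary, on a closed subspace is represented by a bounded
self-adjoint operator. -/
lemma exists_gram (hω : IsStrongSymplectic ω) {L : Submodule ℂ H} (hL : IsClosed (L : Set H))
    {c : ℂ} (hc : conj c = -c) :
    ∃ A : L →L[ℂ] L, IsSelfAdjoint A ∧ ∀ x y : L, inner ℂ y (A x) = c * ω x y := by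
  have : CompleteSpace L := hL.completeSpace_coe
  refine exists_isSelfAdjoint_of_hermitian (c • ω.domRestrict₁₂ L L) ?_ fun x y => ?_
  · change Continuous fun p : L × L => c * ω p.1 p.2
    exact continuous_const.mul (hω.continuous.comp
      (by fun_prop : Continuous fun p : L × L => ((p.1 : H), (p.2 : H))))
  · change c * ω y x = conj (c * ω x y)
    rw [hω.skew x y, map_mul, hc]; ring

/-- Lax–Milgram: the uniform lower bound on L makes the Gram operator coercive. -/
lemma isUnit_gram {L : Submodule ℂ H} (hL : L ∈ WPlus ω) {A : L →L[ℂ] L}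
    (hA : ∀ x y : L, inner ℂ y (A x) = -I * ω x y) : IsUnit A := by
  obtain ⟨hcl, -, -, c, hc, h⟩ := hL
  have : CompleteSpace L := hcl.completeSpace_coe
  refine ContinuousLinearMap.isUnit_of_forall_le_norm_inner_map A (c := ⟨c, hc.le⟩) hc fun x => ?_
  rw [norm_inner_symm, hA]
  calc ‖x‖ ^ 2 * c = c * ‖(x : H)‖ ^ 2 := by rw [mul_comm]; rfl
    _ ≤ _ := h x x.2
    _ ≤ _ := (le_abs_self _).trans (Complex.abs_re_le_norm _)

/-- The L-component of x represents the functional y ↦ -i[y,x] on L with respect to the form; it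
exists because the Gram operator of L is onto. -/
lemma isCompl_sympOrth (hω : IsStrongSymplectic ω) {L : Submodule ℂ H} (hL : L ∈ WPlus ω) :
    IsCompl L (sympOrth ω L) := by
  refine ⟨disjoint_of_isPositiveDefinite hL.2.1, codisjoint_iff.2 (eq_top_iff.2 fun x _ => ?_)⟩
  have : CompleteSpace L := hL.1.completeSpace_coe
  obtain ⟨A, hA, h⟩ := hω.exists_gram hL.1 (c := -I) (by simp)
  have hu := ContinuousLinearMap.isUnit_iff_bijective.1 (isUnit_gram hL h)
  let φ : L →L[ℂ] ℂ :=
    { toFun := fun y => -I * ω y x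
      map_add' := by simp [mul_add]
      map_smul' := by intros; simp; ring
      cont := continuous_const.mul (hω.continuous.comp
        (by fun_prop : Continuous fun y : L => ((y : H), x))) }
  obtain ⟨a, ha⟩ := hu.2 ((InnerProductSpace.toDual ℂ L).symm φ)
  have hax (y : L) : ω (x - a) y = 0 := by
    have h1 : inner ℂ (A a) y = -I * ω y x := by
      rw [ha, InnerProductSpace.toDual_symm_apply]; rfl
    rw [← inner_conj_symm, h, map_mul, hω.skew x y] at h1
    have h2 : ω x y = ω a y := by simpa using (congrArg conj h1).symm
    simp [h2]
  rw [← add_sub_cancel (a : H) x]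
  exact Submodule.add_mem_sup a.2 fun y hy => hax ⟨y, hy⟩

/-- The decomposition `H = L ⊕ L^{⊥ₛ}` for `L ∈ W₊(H)`. -/
lemma exists_prodEquiv (hω : IsStrongSymplectic ω) {L : Submodule ℂ H} (hL : L ∈ WPlus ω) :
    ∃ e : (L × sympOrth ω L) ≃L[ℂ] H, ∀ p, e p = (p.1 : H) + p.2 := by
  have h := hω.isCompl_sympOrth hL
  have : CompleteSpace L := hL.1.completeSpace_coe
  have : CompleteSpace (sympOrth ω L) := (hω.isClosed_sympOrth L).completeSpace_coe
  let f : (L × sympOrth ω L) →L[ℂ] H := L.subtypeL.coprod (sympOrth ω L).subtypeL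
  have hf (p) : f p = Submodule.prodEquivOfIsCompl _ _ h p := by
    simp [f]
  have hker : f.ker = ⊥ := by
    rw [LinearMap.ker_eq_bot]
    intro p q hpq
    apply (Submodule.prodEquivOfIsCompl _ _ h).injective
    rw [← hf, ← hf]; exact hpq
  have hrange : f.range = ⊤ := by
    rw [LinearMap.range_eq_top]
    intro x
    obtain ⟨p, hp⟩ := (Submodule.prodEquivOfIsCompl _ _ h).surjective x
    exact ⟨p, (hf p).trans hp⟩
  refine ⟨ContinuousLinearEquiv.ofBijective f hker hrange, fun p => ?_⟩
  rw [ContinuousLinearEquiv.coeFn_ofBijective]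
  rfl

/-- No uniform bound on L^{⊥ₛ} is given, so invertibility comes from `ω` being strong.
Non-degeneracy yields injectivity. For surjectivity, a functional on L^{⊥ₛ} is extended by 0 along
L; the vector representing it then lies in L^{⊥ₛ}. -/
lemma isUnit_gram_sympOrth (hω : IsStrongSymplectic ω) {L : Submodule ℂ H} (hL : L ∈ WPlus ω)
    {A : sympOrth ω L →L[ℂ] sympOrth ω L}
    (hA : ∀ x y : sympOrth ω L, inner ℂ y (A x) = I * ω x y) : IsUnit A := by
  have : CompleteSpace (sympOrth ω L) := (hω.isClosed_sympOrth L).completeSpace_coe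
  obtain ⟨e, he⟩ := hω.exists_prodEquiv hL
  rw [ContinuousLinearMap.isUnit_iff_bijective]
  constructor
  · rw [injective_iff_map_eq_zero]
    intro x hx
    have h1 (y : sympOrth ω L) : ω x y = 0 := by
      have := hA x y
      rw [hx, inner_zero_right] at this
      simpa using this.symm
    ext
    refine hω.nondegenerate _ fun y => ?_
    rw [← e.apply_symm_apply y, he, map_add, h1, add_zero]
    exact x.2 _ (e.symm y).1.2
  · intro v
    obtain ⟨x, hx⟩ := hω.surjective
      ((InnerProductSpace.toDual ℂ _ v) ∘L ContinuousLinearMap.snd ℂ L _ ∘L e.symm)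
    have hx' (p) : inner ℂ v p.2 = ω (e p) x := by
      rw [← hx]; simp
    have hxL : x ∈ sympOrth ω L := fun y hy => by
      rw [hω.eq_zero_comm]
      simpa [he] using (hx' (⟨y, hy⟩, 0)).symm
    refine ⟨I • ⟨x, hxL⟩, ext_inner_left ℂ fun y => ?_⟩
    rw [hA, ← inner_conj_symm, hx' (0, y), he]
    simp only [ZeroMemClass.coe_zero, zero_add]
    rw [← neg_neg (conj _), ← hω.skew]
    simp only [Submodule.coe_smul, map_smul, smul_eq_mul, LinearMap.smul_apply]
    linear_combination (ω x y) * I_mul_I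

/-- Every `L ∈ W₊(H)` identifies `H` with the standard space `L ⊕ L^{⊥ₛ}`. -/
lemma exists_polarization (hω : IsStrongSymplectic ω) {L : Submodule ℂ H} (hL : L ∈ WPlus ω) :
    ∃ (Sp : L ≃L[ℂ] L) (Sm : sympOrth ω L ≃L[ℂ] sympOrth ω L)
      (Ψ : H ≃L[ℂ] WithLp 2 (L × sympOrth ω L)),
      IsSymplecticIso ω (stdForm L (sympOrth ω L)) Ψ ∧
      ∀ (x : L) (y : sympOrth ω L), Ψ (x + y) = WithLp.toLp 2 (Sp x, Sm y) := by
  have : CompleteSpace L := hL.1.completeSpace_coe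
  have : CompleteSpace (sympOrth ω L) := (hω.isClosed_sympOrth L).completeSpace_coe
  obtain ⟨e, he⟩ := hω.exists_prodEquiv hL
  obtain ⟨A, hA, hAω⟩ := hω.exists_gram hL.1 (c := -I) (by simp)
  -- Passing through the square roots of the Gram operators lets L and L^{⊥ₛ} keep the inner product
  -- of `H` and still serve as H₊ and H₋.
  obtain ⟨Sp, hSp⟩ := exists_equiv_inner_eq hA (isUnit_gram hL hAω) fun y => by
    rw [hAω]
    by_cases h : (y : H) = 0
    · simp [h]
    · exact (hL.2.1 y y.2 h).le
  obtain ⟨A', hA', hAω'⟩ := hω.exists_gram (hω.isClosed_sympOrth L) (c := I) (by simp)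
  obtain ⟨Sm, hSm⟩ := exists_equiv_inner_eq hA' (hω.isUnit_gram_sympOrth hL hAω') fun y => by
    have := hω.re_nonpos_of_maximal hL.2.1 hL.2.2.1 y.2
    rw [hAω']
    simpa using this
  let Ψ := (e.symm.trans (Sp.prodCongr Sm)).trans
    (WithLp.prodContinuousLinearEquiv 2 ℂ L (sympOrth ω L)).symm
  have hΨ (x : L) (y : sympOrth ω L) : Ψ (x + y) = WithLp.toLp 2 (Sp x, Sm y) := by
    have : e.symm ((x : H) + y) = (x, y) := by rw [ContinuousLinearEquiv.symm_apply_eq, he]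
    simp [Ψ, this]
  refine ⟨Sp, Sm, Ψ, fun x y => ?_, hΨ⟩
  rw [← e.apply_symm_apply x, ← e.apply_symm_apply y, he, he]
  generalize e.symm x = p
  generalize e.symm y = q
  rw [hΨ, hΨ, stdForm_apply]
  simp only [WithLp.toLp_fst, WithLp.toLp_snd, hSp, hSm, hAω, hAω', map_add, LinearMap.add_apply]
  rw [hω.eq_zero_comm.1 (q.2.2 _ p.1.2), p.2.2 _ q.1.2]
  linear_combination (-(ω p.1 q.1) - ω p.2 q.2) * I_mul_I

end IsStrongSymplectic

/-- The polarization `N(0)` represents a Nevanlinna disc by a Schur function vanishing at `0`. -/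
theorem IsNevanlinnaDisc.exists_standardRepresentation (hω : IsStrongSymplectic ω)
    {N : 𝔻 → Submodule ℂ H} (hN : IsNevanlinnaDisc ω N) :
    ∃ (Ψ : H ≃L[ℂ] WithLp 2 (N 0 × sympOrth ω (N 0))) (B : ℂ → (N 0 →L[ℂ] sympOrth ω (N 0))),
      IsStandardRepresentation ω N Ψ B ∧ B 0 = 0 := by
  obtain ⟨Sp, Sm, Ψ, hΨ, hΨS⟩ := hω.exists_polarization (hN.1 0)
  obtain ⟨B, hB, hNB⟩ := hN.2 _ (hN.1 0)
  -- The chart operator is corrected by `Sp` and `Sm`, which convert the form into the inner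
  -- products.
  let B' : ℂ → (N 0 →L[ℂ] sympOrth ω (N 0)) := fun z =>
    (Sm : sympOrth ω (N 0) →L[ℂ] sympOrth ω (N 0)) ∘L B z ∘L (Sp.symm : N 0 →L[ℂ] N 0)
  have hgraph (z : 𝔻) : Ψ '' (N z : Set H) = graphOf (B' z) := by
    rw [hNB z]
    ext a
    constructor
    · rintro ⟨_, ⟨x, rfl⟩, rfl⟩
      exact ⟨Sp x, by simp [hΨS, B']⟩
    · rintro ⟨x, rfl⟩
      exact ⟨_, ⟨Sp.symm x, rfl⟩, by simp [hΨS, B']⟩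
  refine ⟨Ψ, B', ⟨hΨ, ⟨?_, fun z => norm_lt_one_of_graph_mem_WPlus hΨ (hN.1 z) (hgraph z)⟩,
    hgraph⟩, ?_⟩
  · intro z hz
    exact (differentiableWithinAt_const _).clm_comp
      ((hB z hz).clm_comp (differentiableWithinAt_const _))
  -- `N 0` is the base point of its own chart: the values of `B 0` lie both in `N 0` and in its
  -- complement.
  · have h0 : B 0 = 0 := by
      ext x
      have h1 : (x : H) + (B 0 x : H) ∈ (N 0 : Set H) := by
        rw [hNB 0]; exact ⟨x, rfl⟩
      have h2 : (B 0 x : H) ∈ N 0 := by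
        simpa using (N 0).sub_mem h1 x.2
      exact Submodule.disjoint_def.1
        (IsStrongSymplectic.disjoint_of_isPositiveDefinite (hN.1 0).2.1) _ h2 (B 0 x).2
    simp [B', h0]

end Hilbert

/-! ### The kernel of a Nevanlinna disc in coordinates -/

section SchurKernel

variable {Hp Hm : Type*} [NormedAddCommGroup Hp] [InnerProductSpace ℂ Hp]
  [NormedAddCommGroup Hm] [InnerProductSpace ℂ Hm]

/-- The two-sided de Branges-Rovnyak kernel of `B`, paired with vectors of the fibres
`{(B(z)* y, y)}` over `𝔻₊` and `{(x, B(z̄) x)}` over `𝔻₋`. -/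
noncomputable def schurKernel (B : ℂ → (Hp →L[ℂ] Hm)) (b c : Bool) (z w : ℂ) (x y : WithLp 2 (Hp × Hm)) : ℂ :=
  match b, c with
  | true, true => (inner ℂ x.snd y.snd - inner ℂ x.fst y.fst) / (1 - z * conj w)
  | false, false => (inner ℂ x.fst y.fst - inner ℂ x.snd y.snd) / (1 - z * conj w)
  -- `dslope` takes the derivative at z = w̄, so the limit value of K is built in.
  | true, false => inner ℂ x.snd (dslope B (conj w) z y.fst)
  | false, true => inner ℂ (dslope B (conj z) w x.fst) y.snd

lemma schurKernel_conj (B : ℂ → (Hp →L[ℂ] Hm)) (b c : Bool) (z w : ℂ)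
    (x y : WithLp 2 (Hp × Hm)) :
    conj (schurKernel B b c z w x y) = schurKernel B c b w z y x := by
  cases b <;> cases c <;>
    simp [schurKernel, mul_comm, inner_conj_symm]

lemma schurKernel_add_right (B : ℂ → (Hp →L[ℂ] Hm)) (b c : Bool) (z w : ℂ)
    (x y y' : WithLp 2 (Hp × Hm)) :
    schurKernel B b c z w x (y + y') = schurKernel B b c z w x y + schurKernel B b c z w x y' := by
  cases b <;> cases c <;> simp [schurKernel] <;> ring

lemma schurKernel_smul_right (B : ℂ → (Hp →L[ℂ] Hm)) (b c : Bool) (z w : ℂ)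
    (x y : WithLp 2 (Hp × Hm)) (a : ℂ) :
    schurKernel B b c z w x (a • y) = a * schurKernel B b c z w x y := by
  cases b <;> cases c <;> simp [schurKernel] <;> ring

end SchurKernel

/-- A quantitative form of the injectivity of 1 - C*C for ‖C‖ < 1; it controls how the projections
𝒫_λ vary with λ. -/
lemma norm_mul_one_sub_le {E F : Type*} [NormedAddCommGroup E] [InnerProductSpace ℂ E]
    [CompleteSpace E] [NormedAddCommGroup F] [InnerProductSpace ℂ F] [CompleteSpace F]
    (C : E →L[ℂ] F) (d : E) :
    ‖d‖ * (1 - ‖C‖ ^ 2) ≤ ‖d - ContinuousLinearMap.adjoint C (C d)‖ := by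
  have h1 : ‖ContinuousLinearMap.adjoint C (C d)‖ ≤ ‖C‖ * (‖C‖ * ‖d‖) := by
    refine (ContinuousLinearMap.le_opNorm _ _).trans ?_
    rw [LinearIsometryEquiv.norm_map]
    gcongr
    exact C.le_opNorm d
  have h2 := norm_sub_norm_le d (ContinuousLinearMap.adjoint C (C d))
  nlinarith

/-! ### Punctured neighbourhoods in the unit disc. -/

namespace Complex.UnitDisc

lemma coe_mem_ball (z : 𝔻) : (z : ℂ) ∈ Metric.ball (0 : ℂ) 1 := by
  simpa using z.norm_lt_one

lemma conj_coe_mem_ball (z : 𝔻) : conj (z : ℂ) ∈ Metric.ball (0 : ℂ) 1 := by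
  simpa using z.norm_lt_one

lemma tendsto_coe_punctured (z : 𝔻) :
    Tendsto (fun w : 𝔻 => (w : ℂ)) (𝓝[≠] z) (𝓝[≠] (z : ℂ)) := by
  refine tendsto_nhdsWithin_iff.2
    ⟨continuous_coe.continuousAt.tendsto.mono_left nhdsWithin_le_nhds, ?_⟩
  filter_upwards [self_mem_nhdsWithin] with w hw
  simpa using hw

lemma tendsto_conj_coe_punctured (z : 𝔻) :
    Tendsto (fun w : 𝔻 => conj (w : ℂ)) (𝓝[≠] z) (𝓝[≠] (conj (z : ℂ))) := by
  refine tendsto_nhdsWithin_iff.2 ⟨((continuous_conj.comp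
    continuous_coe).continuousAt.tendsto).mono_left nhdsWithin_le_nhds, ?_⟩
  filter_upwards [self_mem_nhdsWithin] with w hw
  simpa [(starRingEnd ℂ).injective.eq_iff] using hw

/-- This makes limits along the punctured neighbourhood unique, so that a `Tendsto` statement
determines the `limUnder` in the kernel. -/
instance neBot_punctured (z : 𝔻) : (𝓝[≠] z).NeBot := by
  have h : 𝓝[≠] z = comap (fun w : 𝔻 => (w : ℂ)) (𝓝[≠] (z : ℂ)) := by
    rw [nhdsWithin, nhdsWithin, comap_inf, comap_principal,
      isEmbedding_coe.isInducing.nhds_eq_comap]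
    congr 2
    ext w
    simp
  rw [h]
  refine comap_neBot fun t ht => ?_
  have h2 : t ∩ Metric.ball (0 : ℂ) 1 ∈ 𝓝[≠] (z : ℂ) :=
    inter_mem ht (mem_nhdsWithin_of_mem_nhds (Metric.isOpen_ball.mem_nhds z.coe_mem_ball))
  obtain ⟨w, hw, hw'⟩ := nonempty_of_mem h2
  exact ⟨⟨w, hw'⟩, hw⟩

end Complex.UnitDisc

/-! ### Fibres, projections and kernel in coordinates. -/

section Fibres

variable {H : Type*} [NormedAddCommGroup H] [InnerProductSpace ℂ H] [CompleteSpace H]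
  {ω : H →ₗ[ℂ] H →ₗ⋆[ℂ] ℂ} {N : 𝔻 → Submodule ℂ H}

lemma TwoDiscs.conj_conj (p : TwoDiscs) : p.conj.conj = p := by
  simp [TwoDiscs.conj]

lemma isCompl_extendDisc (hω : IsStrongSymplectic ω) (hN : IsNevanlinnaDisc ω N) (p : TwoDiscs) :
    IsCompl (extendDisc ω N p) (extendDisc ω N p.conj) := by
  obtain ⟨_ | _, z⟩ := p
  · exact (hω.isCompl_sympOrth (hN.1 (star z))).symm
  · simpa [TwoDiscs.conj, extendDisc] using hω.isCompl_sympOrth (hN.1 z)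

lemma isCompl_dualFibre (hω : IsStrongSymplectic ω) (hN : IsNevanlinnaDisc ω N) (p : TwoDiscs) :
    IsCompl (dualFibre ω N p) (dualFibre ω N p.conj) :=
  isCompl_extendDisc hω hN p.conj

omit [CompleteSpace H] in
lemma dualFibre_orthogonal (hω : IsStrongSymplectic ω) {p : TwoDiscs} {x y : H}
    (hx : x ∈ dualFibre ω N p) (hy : y ∈ dualFibre ω N p.conj) : ω x y = 0 := by
  obtain ⟨_ | _, z⟩ := p
  · simp only [dualFibre, TwoDiscs.conj, Bool.not_false, Bool.not_true, extendDisc,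
      star_star] at hx hy
    exact hω.eq_zero_comm.1 (hy x hx)
  · simp only [dualFibre, TwoDiscs.conj, Bool.not_false, Bool.not_true, extendDisc,
      star_star] at hx hy
    exact hx y hy

lemma sub_fibreProj_mem (hω : IsStrongSymplectic ω) (hN : IsNevanlinnaDisc ω N) (p : TwoDiscs)
    (x : H) : x - fibreProj ω N p x ∈ dualFibre ω N p.conj := by
  have h := isCompl_dualFibre hω hN p
  rw [fibreProj, dif_pos h, ← Submodule.projectionOnto_apply_eq_zero_iff h, map_sub,
    Submodule.projectionOnto_apply_left, sub_self]

/-- The projection disappears: x - 𝒫_λx lies in F†_{λ̄}, which is symplectically orthogonal to F†_λ.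
The sign is that of the fibre over λ̄, hence +i for λ in 𝔻₊. -/
lemma kernelQ_eq (hω : IsStrongSymplectic ω) (hN : IsNevanlinnaDisc ω N) (p q : TwoDiscs)
    (x : dualFibre ω N q) (η : dualFibre ω N p) :
    kernelQ ω N p q x η = (if p.1 then I else -I) * ω x η := by
  have h : ω (fibreProj ω N p x : H) η = ω x η := by
    have h1 := hω.eq_zero_comm.1
      (dualFibre_orthogonal hω η.2 (sub_fibreProj_mem hω hN p (x : H)))
    rw [map_sub, LinearMap.sub_apply, sub_eq_zero] at h1
    exact h1.symm
  rw [kernelQ, fibreHerm, h]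
  obtain ⟨_ | _, z⟩ := p <;> simp [TwoDiscs.conj]

variable {Hp Hm : Type*} [NormedAddCommGroup Hp] [InnerProductSpace ℂ Hp]
  [NormedAddCommGroup Hm] [InnerProductSpace ℂ Hm]
  {Ψ : H ≃L[ℂ] WithLp 2 (Hp × Hm)} {B : ℂ → (Hp →L[ℂ] Hm)}

omit [CompleteSpace H] in
lemma IsStandardRepresentation.apply_eq (h : IsStandardRepresentation ω N Ψ B) (x y : H) :
    ω x y = I * inner ℂ (Ψ y).fst (Ψ x).fst - I * inner ℂ (Ψ y).snd (Ψ x).snd := by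
  rw [← h.1, stdForm_apply]

omit [CompleteSpace H] in
lemma IsStandardRepresentation.mem_iff (h : IsStandardRepresentation ω N Ψ B) (z : 𝔻) (x : H) :
    x ∈ N z ↔ (Ψ x).snd = B z (Ψ x).fst := by
  have h1 : x ∈ N z ↔ Ψ x ∈ graphOf (B z) := by
    rw [← h.2.2 z]; exact (Ψ.injective.mem_set_image).symm
  rw [h1]
  constructor
  · rintro ⟨y, hy⟩
    simp [hy]
  · intro hx
    exact ⟨(Ψ x).fst, by rw [← hx]; rfl⟩

variable [CompleteSpace Hp] [CompleteSpace Hm]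

omit [CompleteSpace H] in
lemma IsStandardRepresentation.mem_sympOrth_iff (h : IsStandardRepresentation ω N Ψ B) (z : 𝔻)
    (x : H) :
    x ∈ sympOrth ω (N z) ↔ (Ψ x).fst = ContinuousLinearMap.adjoint (B z) (Ψ x).snd := by
  constructor
  · intro hx
    refine ext_inner_left ℂ fun y => ?_
    have h1 := hx (Ψ.symm (WithLp.toLp 2 (y, B z y))) ((h.mem_iff z _).2 (by simp))
    rw [h.apply_eq] at h1
    simp only [ContinuousLinearEquiv.apply_symm_apply, WithLp.toLp_fst, WithLp.toLp_snd] at h1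
    rw [ContinuousLinearMap.adjoint_inner_right]
    exact mul_left_cancel₀ I_ne_zero (sub_eq_zero.1 h1)
  · intro hx y hy
    rw [h.mem_iff] at hy
    rw [h.apply_eq, hx, hy, ContinuousLinearMap.adjoint_inner_right, sub_self]

omit [CompleteSpace H] in
lemma IsStandardRepresentation.mem_dualFibre_true (h : IsStandardRepresentation ω N Ψ B) (z : 𝔻)
    (x : H) : x ∈ dualFibre ω N (true, z) ↔
      (Ψ x).fst = ContinuousLinearMap.adjoint (B z) (Ψ x).snd := by
  rw [← h.mem_sympOrth_iff]
  simp [dualFibre, TwoDiscs.conj, extendDisc]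

omit [CompleteSpace H] [CompleteSpace Hp] [CompleteSpace Hm] in
lemma IsStandardRepresentation.mem_dualFibre_false (h : IsStandardRepresentation ω N Ψ B) (z : 𝔻)
    (x : H) : x ∈ dualFibre ω N (false, z) ↔ (Ψ x).snd = B (conj (z : ℂ)) (Ψ x).fst := by
  have := h.mem_iff (star z) x
  simpa [dualFibre, TwoDiscs.conj, extendDisc] using this

omit [CompleteSpace H] [CompleteSpace Hp] [CompleteSpace Hm] in
lemma IsStandardRepresentation.differentiableAt (h : IsStandardRepresentation ω N Ψ B) {z : ℂ}
    (hz : z ∈ Metric.ball (0 : ℂ) 1) : DifferentiableAt ℂ B z :=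
  h.2.1.1.differentiableAt (Metric.isOpen_ball.mem_nhds hz)

lemma tendsto_clm_apply {ι E F : Type*} [NormedAddCommGroup E] [NormedAddCommGroup F]
    [NormedSpace ℂ E] [NormedSpace ℂ F] {l : Filter ι} {C : ι → (E →L[ℂ] F)} {C₀ : E →L[ℂ] F}
    {x : ι → E} {x₀ : E} (hC : Tendsto C l (𝓝 C₀)) (hx : Tendsto x l (𝓝 x₀)) :
    Tendsto (fun i => C i (x i)) l (𝓝 (C₀ x₀)) :=
  (isBoundedBilinearMap_apply.continuous.tendsto (C₀, x₀)).comp (hC.prodMk_nhds hx)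

/-- As ‖C₀‖ < 1, the factor 1 - ‖C i‖² has a positive limit and can be divided out. -/
lemma tendsto_of_mul_one_sub_le {ι E F : Type*} [NormedAddCommGroup E] [NormedAddCommGroup F]
    [NormedSpace ℂ E] [NormedSpace ℂ F] {l : Filter ι} {C : ι → (E →L[ℂ] F)} {C₀ : E →L[ℂ] F}
    (hC : Tendsto C l (𝓝 C₀)) (hC₀ : ‖C₀‖ < 1) {G : Type*} [NormedAddCommGroup G]
    {y : ι → G} {y₀ : G} {M : ℝ}
    (hy : ∀ᶠ i in l, ‖y i - y₀‖ * (1 - ‖C i‖ ^ 2) ≤ ‖C i - C₀‖ * M) :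
    Tendsto y l (𝓝 y₀) := by
  rw [tendsto_iff_norm_sub_tendsto_zero]
  have h1 : Tendsto (fun i => 1 - ‖C i‖ ^ 2) l (𝓝 (1 - ‖C₀‖ ^ 2)) :=
    (hC.norm.pow 2).const_sub 1
  have h0 : 0 < 1 - ‖C₀‖ ^ 2 := by nlinarith [norm_nonneg C₀]
  have h2 : Tendsto (fun i => ‖C i - C₀‖ * M / (1 - ‖C i‖ ^ 2)) l (𝓝 0) := by
    have h3 : Tendsto (fun i => ‖C i - C₀‖) l (𝓝 0) := tendsto_iff_norm_sub_tendsto_zero.1 hC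
    have h4 := (h3.mul_const M).div h1 h0.ne'
    rw [zero_mul, zero_div] at h4
    exact h4
  refine squeeze_zero' (Eventually.of_forall fun _ => norm_nonneg _) ?_ h2
  filter_upwards [hy, h1.eventually (lt_mem_nhds h0)] with i hi hi0
  rwa [le_div_iff₀ hi0]

/-- The value of K at λ = μ̄ is a limit along the section w ↦ 𝒫_w η, so the continuity of this
section is needed. Over 𝔻₊ a vector of F† is determined by its second coordinate, and only that one
is followed; over 𝔻₋ it is the first. -/
lemma IsStandardRepresentation.tendsto_fibreProj_true (hω : IsStrongSymplectic ω)
    (hN : IsNevanlinnaDisc ω N) (h : IsStandardRepresentation ω N Ψ B) (z : 𝔻)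
    (η : dualFibre ω N (true, z)) :
    Tendsto (fun w : 𝔻 => (Ψ (fibreProj ω N (true, w) (η : H) : H)).snd) (𝓝[≠] z)
      (𝓝 (Ψ η).snd) := by
  have hB : Tendsto (fun w : 𝔻 => B w) (𝓝[≠] z) (𝓝 (B z)) :=
    ((h.differentiableAt z.coe_mem_ball).continuousAt.tendsto.comp
      ((UnitDisc.tendsto_coe_punctured z).mono_right nhdsWithin_le_nhds))
  refine tendsto_of_mul_one_sub_le (M := ‖(Ψ η).snd‖) hB (h.2.1.2 z) (Eventually.of_forall ?_)
  intro w
  have h1 := (h.mem_dualFibre_true w _).1 (fibreProj ω N (true, w) (η : H)).2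
  have h2 := sub_fibreProj_mem hω hN (true, w) (η : H)
  have h3 : (η : H) - fibreProj ω N (true, w) (η : H) ∈ N w := by
    simpa [dualFibre, TwoDiscs.conj, extendDisc] using h2
  rw [h.mem_iff] at h3
  have h4 := (h.mem_dualFibre_true z _).1 η.2
  simp only [map_sub, WithLp.sub_fst, WithLp.sub_snd, h1, h4] at h3
  generalize (Ψ (fibreProj ω N (true, w) (η : H) : H)).snd = y at h3 ⊢
  set y₀ := (Ψ η).snd
  have hn := norm_mul_one_sub_le (ContinuousLinearMap.adjoint (B w)) (y - y₀)
  rw [ContinuousLinearMap.adjoint_adjoint, LinearIsometryEquiv.norm_map] at hn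
  refine hn.trans ?_
  -- The relation η - 𝒫_w η ∈ N(w) amounts to (1 - B(w)B(w)*)(y - y₀) = B(w)(B(w) - B(z))*y₀.
  have h5 : y - y₀ - B w (ContinuousLinearMap.adjoint (B w) (y - y₀)) =
      B w (ContinuousLinearMap.adjoint (B w - B z) y₀) := by
    simp only [map_sub, _root_.sub_apply]
    rw [← sub_eq_zero] at h3 ⊢
    rw [← neg_eq_zero, ← h3]
    abel
  rw [h5]
  calc _ ≤ ‖B w‖ * (‖B w - B z‖ * ‖y₀‖) := by
        refine (ContinuousLinearMap.le_opNorm _ _).trans ?_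
        gcongr
        refine (ContinuousLinearMap.le_opNorm _ _).trans_eq ?_
        rw [LinearIsometryEquiv.norm_map]
    _ ≤ 1 * (‖B w - B z‖ * ‖y₀‖) := by
        gcongr
        exact (h.2.1.2 w).le
    _ = _ := one_mul _

lemma IsStandardRepresentation.tendsto_fibreProj_false (hω : IsStrongSymplectic ω)
    (hN : IsNevanlinnaDisc ω N) (h : IsStandardRepresentation ω N Ψ B) (z : 𝔻)
    (η : dualFibre ω N (false, z)) :
    Tendsto (fun w : 𝔻 => (Ψ (fibreProj ω N (false, w) (η : H) : H)).fst) (𝓝[≠] z)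
      (𝓝 (Ψ η).fst) := by
  have hB : Tendsto (fun w : 𝔻 => B (conj (w : ℂ))) (𝓝[≠] z) (𝓝 (B (conj (z : ℂ)))) :=
    ((h.differentiableAt z.conj_coe_mem_ball).continuousAt.tendsto.comp
      ((UnitDisc.tendsto_conj_coe_punctured z).mono_right nhdsWithin_le_nhds))
  have hlt (w : 𝔻) : ‖B (conj (w : ℂ))‖ < 1 := h.2.1.2 (star w)
  refine tendsto_of_mul_one_sub_le (M := ‖(Ψ η).fst‖) hB (hlt z) (Eventually.of_forall ?_)
  intro w
  have h1 := (h.mem_dualFibre_false w _).1 (fibreProj ω N (false, w) (η : H)).2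
  have h2 := sub_fibreProj_mem hω hN (false, w) (η : H)
  have h3 : (η : H) - fibreProj ω N (false, w) (η : H) ∈ sympOrth ω (N (star w)) := by
    simpa [dualFibre, TwoDiscs.conj, extendDisc] using h2
  rw [h.mem_sympOrth_iff, UnitDisc.coe_star] at h3
  have h4 := (h.mem_dualFibre_false z _).1 η.2
  simp only [map_sub, WithLp.sub_fst, WithLp.sub_snd, h1, h4] at h3
  generalize (Ψ (fibreProj ω N (false, w) (η : H) : H)).fst = y at h3 ⊢
  set y₀ := (Ψ η).fst
  have hn := norm_mul_one_sub_le (B (conj (w : ℂ))) (y - y₀)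
  refine hn.trans ?_
  have h5 : y - y₀ - ContinuousLinearMap.adjoint (B (conj (w : ℂ))) (B (conj (w : ℂ)) (y - y₀)) =
      ContinuousLinearMap.adjoint (B (conj (w : ℂ))) ((B (conj (w : ℂ)) - B (conj (z : ℂ))) y₀) := by
    simp only [map_sub, _root_.sub_apply]
    rw [← sub_eq_zero] at h3 ⊢
    rw [← neg_eq_zero, ← h3]
    abel
  rw [h5]
  calc _ ≤ ‖B (conj (w : ℂ))‖ * (‖B (conj (w : ℂ)) - B (conj (z : ℂ))‖ * ‖y₀‖) := by
        refine (ContinuousLinearMap.le_opNorm _ _).trans ?_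
        rw [LinearIsometryEquiv.norm_map]
        gcongr
        exact ContinuousLinearMap.le_opNorm _ _
    _ ≤ 1 * (‖B (conj (w : ℂ)) - B (conj (z : ℂ))‖ * ‖y₀‖) := by
        gcongr
        exact (hlt w).le
    _ = _ := one_mul _

/-- The fibre vectors are (x, B(w̄)x) and (B(z)*y, y), and their symplectic product is i((B(z) -
B(w̄))x, y): dividing by z - w̄ produces a difference quotient of B. -/
lemma IsStandardRepresentation.neg_kernelQ_true (hω : IsStrongSymplectic ω)
    (hN : IsNevanlinnaDisc ω N) (h : IsStandardRepresentation ω N Ψ B)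
    {z w : 𝔻} (hzw : (z : ℂ) ≠ conj (w : ℂ)) (x : dualFibre ω N (false, w))
    (η : dualFibre ω N (true, z)) :
    -kernelQ ω N (true, z) (false, w) x η / ((z : ℂ) - conj (w : ℂ)) =
      inner ℂ (Ψ η).snd (slope B (conj (w : ℂ)) z (Ψ x).fst) := by
  have h1 := (h.mem_dualFibre_true z _).1 η.2
  have h2 := (h.mem_dualFibre_false w _).1 x.2
  have h0 := sub_ne_zero.2 hzw
  rw [kernelQ_eq hω hN, h.apply_eq, h1, h2, ContinuousLinearMap.adjoint_inner_left,
    slope_def_module, _root_.smul_apply, inner_smul_right,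
    _root_.sub_apply, inner_sub_right]
  simp only [if_true]
  field_simp
  linear_combination (inner ℂ (Ψ η).snd (B (conj (w : ℂ)) (Ψ x).fst)
    - inner ℂ (Ψ η).snd (B z (Ψ x).fst)) * I_sq

lemma IsStandardRepresentation.neg_kernelQ_false (hω : IsStrongSymplectic ω)
    (hN : IsNevanlinnaDisc ω N) (h : IsStandardRepresentation ω N Ψ B)
    {z w : 𝔻} (hzw : (z : ℂ) ≠ conj (w : ℂ)) (x : dualFibre ω N (true, w))
    (η : dualFibre ω N (false, z)) :
    -kernelQ ω N (false, z) (true, w) x η / ((z : ℂ) - conj (w : ℂ)) =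
      inner ℂ (slope B (w : ℂ) (conj (z : ℂ)) (Ψ η).fst) (Ψ x).snd := by
  have h1 := (h.mem_dualFibre_false z _).1 η.2
  have h2 := (h.mem_dualFibre_true w _).1 x.2
  have h0 := sub_ne_zero.2 hzw
  rw [kernelQ_eq hω hN, h.apply_eq, h1, h2, ContinuousLinearMap.adjoint_inner_right,
    slope_def_module, _root_.smul_apply, inner_smul_left,
    _root_.sub_apply, inner_sub_left, map_inv₀, map_sub, Complex.conj_conj]
  simp only [Bool.false_eq_true, if_false]
  field_simp
  linear_combination (inner ℂ (B w (Ψ η).fst) (Ψ x).snd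
    - inner ℂ (B (conj (z : ℂ)) (Ψ η).fst) (Ψ x).snd) * I_sq

/-- The kernel of a Nevanlinna disc, in the coordinates given by a standard representation. -/
theorem IsStandardRepresentation.kernelPairing_eq (hω : IsStrongSymplectic ω)
    (hN : IsNevanlinnaDisc ω N) (h : IsStandardRepresentation ω N Ψ B)
    (p q : TwoDiscs) (x : dualFibre ω N q) (η : dualFibre ω N p) :
    kernelPairing ω N p q x η = schurKernel B p.1 q.1 p.2 q.2 (Ψ η) (Ψ x) := by
  obtain ⟨_ | _, z⟩ := p <;> obtain ⟨_ | _, w⟩ := q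
  · simp only [kernelPairing, if_true, schurKernel]
    rw [kernelQ_eq hω hN, h.apply_eq]
    simp only [Bool.false_eq_true, if_false]
    congr 1
    linear_combination (inner ℂ (Ψ η).snd (Ψ x).snd - inner ℂ (Ψ η).fst (Ψ x).fst) * I_mul_I
  · simp only [kernelPairing, Bool.false_eq_true, if_false, schurKernel]
    by_cases hzw : z = star w
    · have hw : conj (z : ℂ) = w := by simp [hzw]
      rw [if_pos hzw, hw, dslope_same]
      -- At z = w̄ the difference quotients tend to the derivative in operator norm and the
      -- projected vectors tend to η, so their pairing converges.
      apply Tendsto.limUnder_eq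
      have h1 : Tendsto (fun u : 𝔻 => slope B w (conj (u : ℂ))) (𝓝[≠] z) (𝓝 (deriv B w)) := by
        refine (hasDerivAt_iff_tendsto_slope.1
          (h.differentiableAt w.coe_mem_ball).hasDerivAt).comp ?_
        rw [← hw]
        exact UnitDisc.tendsto_conj_coe_punctured z
      have h2 := h.tendsto_fibreProj_false hω hN z η
      have h3 : Tendsto (fun u : 𝔻 => inner ℂ (slope B (w : ℂ) (conj (u : ℂ))
          (Ψ (fibreProj ω N (false, u) (η : H) : H)).fst) (Ψ x).snd) (𝓝[≠] z)
          (𝓝 (inner ℂ (deriv B w (Ψ η).fst) (Ψ x).snd)) :=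
        (tendsto_clm_apply h1 h2).inner tendsto_const_nhds
      refine h3.congr' ?_
      filter_upwards [self_mem_nhdsWithin] with u hu
      refine (h.neg_kernelQ_false hω hN (fun huw => hu ?_) x _).symm
      rw [Set.mem_singleton_iff, hzw]
      exact UnitDisc.coe_injective huw
    · rw [if_neg hzw]
      have hzw' : (z : ℂ) ≠ conj (w : ℂ) := fun h => hzw (UnitDisc.coe_injective h)
      rw [h.neg_kernelQ_false hω hN hzw', dslope_of_ne, slope_comm]
      intro h'
      exact hzw' (by rw [h', Complex.conj_conj])
  · simp only [kernelPairing, Bool.true_eq_false, if_false, schurKernel]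
    by_cases hzw : z = star w
    · have hw : conj (w : ℂ) = z := by simp [hzw]
      rw [if_pos hzw, hw, dslope_same]
      apply Tendsto.limUnder_eq
      have h1 : Tendsto (fun u : 𝔻 => slope B z (u : ℂ)) (𝓝[≠] z) (𝓝 (deriv B z)) :=
        (hasDerivAt_iff_tendsto_slope.1
          (h.differentiableAt z.coe_mem_ball).hasDerivAt).comp
          (UnitDisc.tendsto_coe_punctured z)
      have h2 := h.tendsto_fibreProj_true hω hN z η
      have h3 : Tendsto (fun u : 𝔻 => inner ℂ (Ψ (fibreProj ω N (true, u) (η : H) : H)).snd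
          (slope B (z : ℂ) (u : ℂ) (Ψ x).fst)) (𝓝[≠] z)
          (𝓝 (inner ℂ (Ψ η).snd (deriv B z (Ψ x).fst))) :=
        h2.inner (tendsto_clm_apply h1 tendsto_const_nhds)
      refine h3.congr' ?_
      filter_upwards [self_mem_nhdsWithin] with u hu
      have huw : (u : ℂ) ≠ conj (w : ℂ) := by
        rw [hw]
        exact fun h => hu (UnitDisc.coe_injective h)
      have h4 := h.neg_kernelQ_true hω hN huw x (fibreProj ω N (true, u) (η : H))
      rw [hw] at h4
      exact h4.symm
    · rw [if_neg hzw]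
      have hzw' : (z : ℂ) ≠ conj (w : ℂ) := fun h => hzw (UnitDisc.coe_injective h)
      rw [h.neg_kernelQ_true hω hN hzw', dslope_of_ne _ hzw']
  · simp only [kernelPairing, if_true, schurKernel]
    rw [kernelQ_eq hω hN, h.apply_eq]
    simp only [if_true]
    congr 1
    linear_combination (inner ℂ (Ψ η).fst (Ψ x).fst - inner ℂ (Ψ η).snd (Ψ x).snd) * I_mul_I

end Fibres

/-! ### Positivity of the kernel -/

section CircleAverages

open Metric Real

/-- The scalar weight on the unit circle attached to a point of `𝔻₊` or `𝔻₋`. -/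
noncomputable def circleWeight (b : Bool) (z t : ℂ) : ℂ :=
  -- The weights of 𝔻₊ lie in the Hardy space of the disc, those of 𝔻₋ in its orthogonal complement,
  -- so constants contribute nothing to mixed averages. The sign over 𝔻₊ compensates that of the
  -- off-diagonal entries of `contractionForm`.
  if b then -(1 - conj z * t)⁻¹ else (t - conj z)⁻¹

lemma one_sub_mul_ne_zero {z t : ℂ} (hz : ‖z‖ < 1) (ht : ‖t‖ ≤ 1) : 1 - z * t ≠ 0 := by
  intro h
  have h1 : ‖z * t‖ = 1 := by rw [← sub_eq_zero.1 h, norm_one]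
  rw [norm_mul] at h1
  nlinarith [norm_nonneg z, norm_nonneg t]

lemma sub_ne_zero_of_norm {z t : ℂ} (hz : ‖z‖ < 1) (ht : ‖t‖ = 1) : t - z ≠ 0 := by
  intro h
  rw [sub_eq_zero.1 h] at ht
  linarith

lemma continuousOn_circleWeight (b : Bool) {z : ℂ} (hz : ‖z‖ < 1) :
    ContinuousOn (circleWeight b z) (sphere 0 1) := by
  have hz' : ‖conj z‖ < 1 := by simpa using hz
  intro t ht
  have ht' : ‖t‖ = 1 := by simpa using ht
  apply ContinuousAt.continuousWithinAt
  unfold circleWeight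
  cases b
  · simp only [Bool.false_eq_true, if_false]
    exact (by fun_prop : ContinuousAt (fun t : ℂ => t - conj z) t).inv₀
      (sub_ne_zero_of_norm hz' ht')
  · simp only [if_true]
    exact ((by fun_prop : ContinuousAt (fun t : ℂ => 1 - conj z * t) t).inv₀
      (one_sub_mul_ne_zero hz' ht'.le)).neg

lemma conj_circleAverage (f : ℂ → ℂ) :
    conj (circleAverage f 0 1) = circleAverage (fun t => conj (f t)) 0 1 := by
  simp only [circleAverage_def]
  rw [intervalIntegral.integral_of_le two_pi_pos.le, intervalIntegral.integral_of_le two_pi_pos.le,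
    integral_conj, Complex.real_smul, Complex.real_smul, map_mul, conj_ofReal]

variable {φ : ℂ → ℂ} {z w : ℂ}

lemma circleAverage_cauchy (hφ : DifferentiableOn ℂ φ (closedBall 0 1)) (hz : ‖z‖ < 1) :
    circleAverage (fun t => t / (t - z) * φ t) 0 1 = φ z := by
  have h : DiffContOnCl ℂ φ (ball 0 |(1 : ℝ)|) := by
    refine DifferentiableOn.diffContOnCl ?_
    rwa [abs_one, closure_ball _ one_ne_zero]
  have := h.circleAverage_smul_div (w := z) (by simpa using hz)
  simpa using this

lemma differentiableOn_inv_one_sub_mul (hz : ‖z‖ < 1) :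
    DifferentiableOn ℂ (fun t => (1 - z * t)⁻¹) (closedBall 0 1) := by
  intro t ht
  refine DifferentiableAt.differentiableWithinAt ?_
  exact (by fun_prop : DifferentiableAt ℂ (fun t : ℂ => 1 - z * t) t).inv
    (one_sub_mul_ne_zero hz (by simpa using ht))

lemma conj_eq_inv_of_norm_eq_one {t : ℂ} (ht : ‖t‖ = 1) : conj t = t⁻¹ :=
  (inv_eq_conj ht).symm

/-- On the circle t̄ = 1/t, so the conjugated weight is, up to sign, the Cauchy kernel at z, and the
other factors are holomorphic. -/
lemma circleAverage_weight_true_true (hφ : DifferentiableOn ℂ φ (closedBall 0 1)) (hz : ‖z‖ < 1)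
    (hw : ‖w‖ < 1) :
    circleAverage (fun t => conj (circleWeight true z t) * circleWeight true w t * φ t) 0 1 =
      φ z / (1 - z * conj w) := by
  have hw' : ‖conj w‖ < 1 := by simpa using hw
  have h := circleAverage_cauchy ((differentiableOn_inv_one_sub_mul hw').mul hφ) hz
  rw [show φ z / (1 - z * conj w) = (1 - conj w * z)⁻¹ * φ z by rw [mul_comm z]; ring]
  refine Eq.trans ?_ h
  refine circleAverage_congr_sphere fun t ht => ?_
  have ht' : ‖t‖ = 1 := by simpa using ht
  have ht0 : t ≠ 0 := by rintro rfl; simp at ht'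
  have h1 := sub_ne_zero_of_norm hz ht'
  have h2 := one_sub_mul_ne_zero hw' ht'.le
  have h3 : 1 - z * t⁻¹ = (t - z) / t := by field_simp
  simp only [circleWeight, if_true, map_neg, map_inv₀, map_sub, map_one, map_mul,
    Complex.conj_conj, conj_eq_inv_of_norm_eq_one ht', h3, Pi.mul_apply]
  field_simp

/-- Here the Cauchy kernel comes from the second weight, with its pole at w̄. -/
lemma circleAverage_weight_false_false (hφ : DifferentiableOn ℂ φ (closedBall 0 1))
    (hz : ‖z‖ < 1) (hw : ‖w‖ < 1) :
    circleAverage (fun t => conj (circleWeight false z t) * circleWeight false w t * φ t) 0 1 =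
      φ (conj w) / (1 - z * conj w) := by
  have hw' : ‖conj w‖ < 1 := by simpa using hw
  have h := circleAverage_cauchy ((differentiableOn_inv_one_sub_mul hz).mul hφ) hw'
  rw [show φ (conj w) / (1 - z * conj w) = (1 - z * conj w)⁻¹ * φ (conj w) by ring]
  refine Eq.trans ?_ h
  refine circleAverage_congr_sphere fun t ht => ?_
  have ht' : ‖t‖ = 1 := by simpa using ht
  have ht0 : t ≠ 0 := by rintro rfl; simp at ht'
  have h1 := sub_ne_zero_of_norm hw' ht'
  have h2 := one_sub_mul_ne_zero hz ht'.le
  have h3 : t⁻¹ - z = (1 - z * t) / t := by field_simp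
  simp only [circleWeight, Bool.false_eq_true, if_false, map_inv₀, map_sub,
    Complex.conj_conj, conj_eq_inv_of_norm_eq_one ht', h3, Pi.mul_apply]
  field_simp

/-- No pole is left in the disc and a factor t appears, so Cauchy's formula at 0 gives 0. -/
lemma circleAverage_weight_false_true (hφ : DifferentiableOn ℂ φ (closedBall 0 1))
    (hz : ‖z‖ < 1) (hw : ‖w‖ < 1) :
    circleAverage (fun t => conj (circleWeight false z t) * circleWeight true w t * φ t) 0 1 =
      0 := by
  have hw' : ‖conj w‖ < 1 := by simpa using hw
  have h := circleAverage_cauchy (z := 0) ((((differentiableOn_inv_one_sub_mul hz).mul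
    (differentiableOn_inv_one_sub_mul hw')).mul hφ).mul (differentiableOn_id.neg)) (by simp)
  refine Eq.trans ?_ (h.trans (by simp))
  refine circleAverage_congr_sphere fun t ht => ?_
  have ht' : ‖t‖ = 1 := by simpa using ht
  have ht0 : t ≠ 0 := by rintro rfl; simp at ht'
  have h1 := one_sub_mul_ne_zero hw' ht'.le
  have h2 := one_sub_mul_ne_zero hz ht'.le
  have h3 : t⁻¹ - z = (1 - z * t) / t := by field_simp
  simp only [circleWeight, Bool.false_eq_true, if_false, map_inv₀, map_sub, if_true,
    Complex.conj_conj, conj_eq_inv_of_norm_eq_one ht', h3, Pi.mul_apply, Pi.neg_apply, id, sub_zero]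
  field_simp

lemma circleIntegrable_weight {b c : Bool} (hφ : ContinuousOn φ (sphere 0 1)) (hz : ‖z‖ < 1)
    (hw : ‖w‖ < 1) :
    CircleIntegrable (fun t => conj (circleWeight b z t) * circleWeight c w t * φ t) 0 1 :=
  ContinuousOn.circleIntegrable zero_le_one
    (((continuous_conj.comp_continuousOn (continuousOn_circleWeight b hz)).mul
      (continuousOn_circleWeight c hw)).mul hφ)

/-- Both weights have poles in the disc. The constant φ(w̄) has average 0, by the conjugate of the
preceding case; after its subtraction the pole at w̄ is absorbed in the holomorphic `dslope`, and
the Cauchy kernel at z remains. -/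
lemma circleAverage_weight_true_false (hφ : DifferentiableOn ℂ φ (closedBall 0 1))
    (hz : ‖z‖ < 1) (hw : ‖w‖ < 1) :
    circleAverage (fun t => conj (circleWeight true z t) * circleWeight false w t * φ t) 0 1 =
      -dslope φ (conj w) z := by
  have hw' : ‖conj w‖ < 1 := by simpa using hw
  have hd : DifferentiableOn ℂ (dslope φ (conj w)) (closedBall 0 1) :=
    (Complex.differentiableOn_dslope (closedBall_mem_nhds_of_mem (by simpa using hw))).2 hφ
  have h := circleAverage_cauchy hd.neg hz
  have h' := congrArg conj (circleAverage_weight_false_true (φ := fun _ => conj (φ (conj w)))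
    (differentiableOn_const _) hw hz)
  rw [conj_circleAverage, map_zero] at h'
  have hsum : circleAverage (fun t => t / (t - z) * (-dslope φ (conj w)) t +
      conj (conj (circleWeight false w t) * circleWeight true z t * conj (φ (conj w)))) 0 1 =
      -dslope φ (conj w) z := by
    rw [circleAverage_fun_add, h, h', add_zero, Pi.neg_apply]
    · refine ContinuousOn.circleIntegrable zero_le_one (ContinuousOn.mul ?_ ?_)
      · refine continuousOn_id.div (by fun_prop) fun t ht => ?_
        exact sub_ne_zero_of_norm hz (by simpa using ht)
      · exact (hd.continuousOn.mono sphere_subset_closedBall).neg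
    · exact ContinuousOn.circleIntegrable zero_le_one
        (continuous_conj.comp_continuousOn
          (((continuous_conj.comp_continuousOn (continuousOn_circleWeight false hw)).mul
          (continuousOn_circleWeight true hz)).mul continuousOn_const))
  rw [← hsum]
  refine circleAverage_congr_sphere fun t ht => ?_
  have ht' : ‖t‖ = 1 := by simpa using ht
  have ht0 : t ≠ 0 := by rintro rfl; simp at ht'
  have h1 := sub_ne_zero_of_norm hz ht'
  have h2 := sub_ne_zero_of_norm hw' ht'
  have h3 : 1 - z * t⁻¹ = (t - z) / t := by field_simp
  simp only [circleWeight, Bool.false_eq_true, if_false, if_true, map_neg, map_inv₀, map_sub,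
    map_one, map_mul, Complex.conj_conj, conj_eq_inv_of_norm_eq_one ht', h3, Pi.neg_apply,
    dslope_of_ne _ (sub_ne_zero.1 h2), slope_def_module, smul_eq_mul]
  field_simp
  ring

end CircleAverages

/-! ### Positivity for Schur functions holomorphic up to the circle. -/

section Positivity

open Metric Real

variable {Hp Hm : Type*} [NormedAddCommGroup Hp] [InnerProductSpace ℂ Hp]
  [NormedAddCommGroup Hm] [InnerProductSpace ℂ Hm]

/-- The Hermitian form of the operator matrix `(1, -C*; -C, 1)`. -/
noncomputable def contractionForm (C : Hp →L[ℂ] Hm) (x y : WithLp 2 (Hp × Hm)) : ℂ :=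
  inner ℂ x.fst y.fst + inner ℂ x.snd y.snd - inner ℂ x.snd (C y.fst) - inner ℂ (C x.fst) y.snd

lemma contractionForm_conj (C : Hp →L[ℂ] Hm) (x y : WithLp 2 (Hp × Hm)) :
    conj (contractionForm C x y) = contractionForm C y x := by
  simp only [contractionForm, map_add, map_sub, inner_conj_symm]
  ring

/-- The sum is the form at the single vector (u, v) = ∑ aᵢxᵢ, and ‖u‖² + ‖v‖² - 2 Re(Cu, v) ≥ (‖u‖ -
‖v‖)². -/
lemma re_contractionForm_sum_nonneg {ι : Type*} (s : Finset ι) {C : Hp →L[ℂ] Hm} (hC : ‖C‖ ≤ 1)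
    (a : ι → ℂ) (x : ι → WithLp 2 (Hp × Hm)) :
    0 ≤ (∑ i ∈ s, ∑ j ∈ s, conj (a i) * a j * contractionForm C (x i) (x j)).re := by
  set u := ∑ i ∈ s, a i • (x i).fst with hu
  set v := ∑ i ∈ s, a i • (x i).snd with hv
  have h : ∑ i ∈ s, ∑ j ∈ s, conj (a i) * a j * contractionForm C (x i) (x j) =
      inner ℂ u u + inner ℂ v v - inner ℂ v (C u) - inner ℂ (C u) v := by
    simp only [hu, hv, map_sum, map_smul, sum_inner, inner_sum, inner_smul_left, inner_smul_right,
      Finset.mul_sum, ← Finset.sum_add_distrib, ← Finset.sum_sub_distrib, contractionForm]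
    rw [Finset.sum_comm]
    refine Finset.sum_congr rfl fun i _ => Finset.sum_congr rfl fun j _ => ?_
    ring
  rw [h]
  have h1 : (inner ℂ v (C u)).re ≤ ‖v‖ * ‖u‖ := by
    refine (re_inner_le_norm (𝕜 := ℂ) v (C u)).trans ?_
    gcongr
    simpa using C.le_of_opNorm_le hC u
  have h2 : (inner ℂ (C u) v).re = (inner ℂ v (C u)).re := by
    rw [← inner_conj_symm, conj_re]
  have h3 : (inner ℂ u u).re = ‖u‖ ^ 2 := inner_self_eq_norm_sq (𝕜 := ℂ) u
  have h4 : (inner ℂ v v).re = ‖v‖ ^ 2 := inner_self_eq_norm_sq (𝕜 := ℂ) v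
  simp only [add_re, sub_re, h2, h3, h4]
  nlinarith [sq_nonneg (‖u‖ - ‖v‖)]

variable [CompleteSpace Hp] [CompleteSpace Hm]

/-- The fibres of the bundle `F†` in coordinates: `{(B(z)* y, y)}` over `𝔻₊` and `{(x, B(z̄) x)}`
over `𝔻₋`. -/
def MemSchurFibre (B : ℂ → (Hp →L[ℂ] Hm)) (b : Bool) (z : ℂ) (x : WithLp 2 (Hp × Hm)) : Prop :=
  if b then x.fst = ContinuousLinearMap.adjoint (B z) x.snd else x.snd = B (conj z) x.fst

variable {B : ℂ → (Hp →L[ℂ] Hm)}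

omit [CompleteSpace Hp] [CompleteSpace Hm] in
lemma differentiableOn_inner_apply (hB : DifferentiableOn ℂ B (closedBall 0 1)) (x : Hm) (y : Hp) :
    DifferentiableOn ℂ (fun t => inner ℂ x (B t y)) (closedBall 0 1) := by
  have h1 : DifferentiableOn ℂ (fun t => B t y) (closedBall 0 1) :=
    hB.clm_apply (differentiableOn_const y)
  exact (innerSL ℂ x).differentiable.comp_differentiableOn h1

omit [CompleteSpace Hp] [CompleteSpace Hm] in
lemma dslope_inner_apply {a : ℂ} (hB : DifferentiableAt ℂ B a) (x : Hm) (y : Hp) (z : ℂ) :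
    dslope (fun t => inner ℂ x (B t y)) a z = inner ℂ x (dslope B a z y) := by
  let L : (Hp →L[ℂ] Hm) →L[ℂ] ℂ := (innerSL ℂ x) ∘L (ContinuousLinearMap.apply ℂ Hm y)
  exact L.dslope_comp B a z fun _ => hB

/-- For `B` holomorphic up to the boundary, the kernel is an average over the unit circle. -/
lemma schurKernel_eq_circleAverage (hB : DifferentiableOn ℂ B (closedBall 0 1))
    (b c : Bool) {z w : ℂ} (hz : ‖z‖ < 1) (hw : ‖w‖ < 1) {x y : WithLp 2 (Hp × Hm)}
    (hx : MemSchurFibre B b z x) (hy : MemSchurFibre B c w y) :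
    schurKernel B b c z w x y = circleAverage (fun t => conj (circleWeight b z t) *
      circleWeight c w t * contractionForm (B t) x y) 0 1 := by
  -- The form is split into a constant, a holomorphic and an antiholomorphic part; the last is the
  -- conjugate of a holomorphic one with the weights exchanged.
  have hexp (b c : Bool) (z w : ℂ) (hz : ‖z‖ < 1) (hw : ‖w‖ < 1) (x y : WithLp 2 (Hp × Hm)) :
      circleAverage (fun t => conj (circleWeight b z t) *
        circleWeight c w t * contractionForm (B t) x y) 0 1 =
      circleAverage (fun t => conj (circleWeight b z t) * circleWeight c w t *
        (inner ℂ x.fst y.fst + inner ℂ x.snd y.snd)) 0 1 -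
      circleAverage (fun t => conj (circleWeight b z t) * circleWeight c w t *
        inner ℂ x.snd (B t y.fst)) 0 1 -
      conj (circleAverage (fun t => conj (circleWeight c w t) * circleWeight b z t *
        inner ℂ y.snd (B t x.fst)) 0 1) := by
    have hφ (u : Hm) (v : Hp) : ContinuousOn (fun t => inner ℂ u (B t v)) (sphere 0 1) :=
      (differentiableOn_inner_apply hB u v).continuousOn.mono sphere_subset_closedBall
    have e (t : ℂ) : conj (conj (circleWeight c w t) * circleWeight b z t *
        inner ℂ y.snd (B t x.fst)) = conj (circleWeight b z t) * circleWeight c w t *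
        conj (inner ℂ y.snd (B t x.fst)) := by
      simp only [map_mul, Complex.conj_conj]
      ring
    rw [conj_circleAverage, ← circleAverage_fun_sub, ← circleAverage_fun_sub]
    · congr 1
      ext t
      rw [e, inner_conj_symm, contractionForm]
      ring
    · simp_rw [← mul_sub]
      exact circleIntegrable_weight (continuousOn_const.sub (hφ _ _)) hz hw
    · simp_rw [e]
      exact circleIntegrable_weight (continuous_conj.comp_continuousOn (hφ _ _)) hz hw
    · exact circleIntegrable_weight continuousOn_const hz hw
    · exact circleIntegrable_weight (hφ _ _) hz hw
  have hmixed (z w : ℂ) (hz : ‖z‖ < 1) (hw : ‖w‖ < 1) (x y : WithLp 2 (Hp × Hm)) :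
      schurKernel B true false z w x y = circleAverage (fun t => conj (circleWeight true z t) *
        circleWeight false w t * contractionForm (B t) x y) 0 1 := by
    rw [hexp _ _ _ _ hz hw,
      circleAverage_weight_true_false (differentiableOn_const _) hz hw,
      circleAverage_weight_true_false (differentiableOn_inner_apply hB _ _) hz hw,
      circleAverage_weight_false_true (differentiableOn_inner_apply hB _ _) hw hz,
      dslope_inner_apply (hB.differentiableAt (closedBall_mem_nhds_of_mem (by simpa using hw)))]
    have h0 : dslope (fun _ : ℂ => inner ℂ x.fst y.fst + inner ℂ x.snd y.snd) (conj w) z = 0 := by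
      by_cases h : z = conj w
      · simp [h]
      · simp [dslope_of_ne _ h, slope_def_module]
    simp [h0, schurKernel]
  cases b <;> cases c
  · have hx' : x.snd = B (conj z) x.fst := hx
    have hy' : y.snd = B (conj w) y.fst := hy
    rw [hexp _ _ _ _ hz hw,
      circleAverage_weight_false_false (differentiableOn_const _) hz hw,
      circleAverage_weight_false_false (differentiableOn_inner_apply hB _ _) hz hw,
      circleAverage_weight_false_false (differentiableOn_inner_apply hB _ _) hw hz]
    -- By the fibre relations both off-diagonal averages have numerator (y₂, x₂) or its conjugate;
    -- removing it twice from the constant part changes the sign of that term.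
    rw [← hx', ← hy', map_div₀, inner_conj_symm]
    simp only [schurKernel, map_sub, map_one, map_mul, Complex.conj_conj]
    rw [mul_comm (conj w) z]
    ring
  · rw [← schurKernel_conj, hmixed _ _ hw hz, conj_circleAverage]
    congr 1
    ext t
    simp only [map_mul, Complex.conj_conj, contractionForm_conj]
    ring
  · exact hmixed _ _ hz hw x y
  · have hx' : x.fst = ContinuousLinearMap.adjoint (B z) x.snd := hx
    have hy' : y.fst = ContinuousLinearMap.adjoint (B w) y.snd := hy
    rw [hexp _ _ _ _ hz hw,
      circleAverage_weight_true_true (differentiableOn_const _) hz hw,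
      circleAverage_weight_true_true (differentiableOn_inner_apply hB _ _) hz hw,
      circleAverage_weight_true_true (differentiableOn_inner_apply hB _ _) hw hz]
    rw [← ContinuousLinearMap.adjoint_inner_left, ← ContinuousLinearMap.adjoint_inner_left,
      ← hx', ← hy', map_div₀, inner_conj_symm]
    simp only [schurKernel, map_sub, map_one, map_mul, Complex.conj_conj]
    rw [mul_comm (conj w) z]
    ring

/-- The weights are absorbed into the coefficients, so the integrand at each t is a value of the
positive form `contractionForm (B t)`. -/
lemma re_schurKernel_sum_nonneg_of_closedBall {ι : Type*} (s : Finset ι)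
    (hB : DifferentiableOn ℂ B (closedBall 0 1)) (hB1 : ∀ t ∈ sphere (0 : ℂ) 1, ‖B t‖ ≤ 1)
    (b : ι → Bool) (z : ι → ℂ) (hz : ∀ i, ‖z i‖ < 1) (x : ι → WithLp 2 (Hp × Hm))
    (hx : ∀ i, MemSchurFibre B (b i) (z i) (x i)) (a : ι → ℂ) :
    0 ≤ (∑ i ∈ s, ∑ j ∈ s,
      conj (a i) * a j * schurKernel B (b i) (b j) (z i) (z j) (x i) (x j)).re := by
  have hcont (i j : ι) : ContinuousOn (fun t => contractionForm (B t) (x i) (x j)) (sphere 0 1) := by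
    have hBt : ContinuousOn B (sphere 0 1) := hB.continuousOn.mono sphere_subset_closedBall
    unfold contractionForm
    fun_prop
  have hint (i j : ι) : CircleIntegrable (fun t => conj (a i) * a j *
      (conj (circleWeight (b i) (z i) t) * circleWeight (b j) (z j) t *
        contractionForm (B t) (x i) (x j))) 0 1 :=
    (circleIntegrable_weight (hcont i j) (hz i) (hz j)).const_fun_smul
  have h : ∑ i ∈ s, ∑ j ∈ s,
      conj (a i) * a j * schurKernel B (b i) (b j) (z i) (z j) (x i) (x j) =
      circleAverage (fun t => ∑ i ∈ s, ∑ j ∈ s, conj (a i) * a j *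
      (conj (circleWeight (b i) (z i) t) * circleWeight (b j) (z j) t *
        contractionForm (B t) (x i) (x j))) 0 1 := by
    rw [circleAverage_fun_sum fun i _ => CircleIntegrable.fun_sum _ fun j _ => hint i j]
    refine Finset.sum_congr rfl fun i _ => ?_
    rw [circleAverage_fun_sum fun j _ => hint i j]
    refine Finset.sum_congr rfl fun j _ => ?_
    rw [schurKernel_eq_circleAverage hB (b i) (b j) (hz i) (hz j) (hx i) (hx j)]
    exact (circleAverage_fun_smul (a := conj (a i) * a j)).symm
  rw [h]
  have hre := ContinuousLinearMap.circleAverage_comp_comm Complex.reCLM (c := 0) (R := 1)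
    (f := fun t => ∑ i ∈ s, ∑ j ∈ s, conj (a i) * a j *
      (conj (circleWeight (b i) (z i) t) * circleWeight (b j) (z j) t *
        contractionForm (B t) (x i) (x j)))
    (CircleIntegrable.fun_sum _ fun i _ => CircleIntegrable.fun_sum _ fun j _ => hint i j)
  rw [← reCLM_apply, ← hre]
  refine circleAverage_nonneg_of_nonneg fun t ht => ?_
  have := re_contractionForm_sum_nonneg s (hB1 t (by simpa using ht))
    (fun i => a i * circleWeight (b i) (z i) t) x
  refine this.trans_eq ?_
  simp only [Function.comp, reCLM_apply]
  congr 1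
  refine Finset.sum_congr rfl fun i _ => Finset.sum_congr rfl fun j _ => ?_
  rw [map_mul]
  ring

end Positivity

/-! ### Passage to general Schur functions by dilation. -/

section PositivityLimit

open Metric

variable {Hp Hm : Type*} [NormedAddCommGroup Hp] [InnerProductSpace ℂ Hp]
  [NormedAddCommGroup Hm] [InnerProductSpace ℂ Hm] {B : ℂ → (Hp →L[ℂ] Hm)}

lemma tendsto_dilate {z : ℂ} (hB : ContinuousAt B z) :
    Tendsto (fun r : ℝ => B (r * z)) (𝓝[<] 1) (𝓝 (B z)) := by
  have h : Tendsto (fun r : ℝ => (r : ℂ) * z) (𝓝[<] 1) (𝓝 z) := by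
    have : Tendsto (fun r : ℝ => (r : ℂ) * z) (𝓝 1) (𝓝 (((1 : ℝ) : ℂ) * z)) :=
      Continuous.tendsto (by fun_prop) 1
    simp only [ofReal_one, one_mul] at this
    exact this.mono_left nhdsWithin_le_nhds
  exact hB.tendsto.comp h

lemma tendsto_dslope_dilate [CompleteSpace Hm] (hB : DifferentiableOn ℂ B (ball 0 1)) {a z : ℂ}
    (ha : a ∈ ball (0 : ℂ) 1) (hz : z ∈ ball (0 : ℂ) 1) :
    Tendsto (fun r : ℝ => dslope (fun t => B (r * t)) a z) (𝓝[<] 1) (𝓝 (dslope B a z)) := by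
  have hc {t : ℂ} (ht : t ∈ ball (0 : ℂ) 1) : ContinuousAt B t :=
    (hB.differentiableAt (isOpen_ball.mem_nhds ht)).continuousAt
  by_cases h : z = a
  · subst h
    simp only [dslope_same]
    have h1 (r : ℝ) : deriv (fun t => B (r * t)) z = (r : ℂ) • deriv B (r * z) :=
      deriv_comp_mul_left _ _ _
    simp_rw [h1]
    have h2 : ContinuousAt (deriv B) z :=
      ((hB.deriv isOpen_ball).differentiableAt (isOpen_ball.mem_nhds hz)).continuousAt
    have h3 : Tendsto (fun r : ℝ => deriv B (r * z)) (𝓝[<] 1) (𝓝 (deriv B z)) := by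
      exact tendsto_dilate h2
    have h4 : Tendsto (fun r : ℝ => (r : ℂ)) (𝓝[<] 1) (𝓝 1) :=
      (Continuous.tendsto' continuous_ofReal 1 1 (by simp)).mono_left nhdsWithin_le_nhds
    simpa using h4.smul h3
  · simp only [dslope_of_ne _ h, slope_def_module]
    exact ((tendsto_dilate (hc hz)).sub (tendsto_dilate (hc ha))).const_smul _

variable [CompleteSpace Hp] [CompleteSpace Hm]

/-- The two-sided de Branges-Rovnyak kernel of a Schur function is positive. -/
theorem re_schurKernel_sum_nonneg {ι : Type*} (s : Finset ι) (hB : IsStrictSchur B)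
    (b : ι → Bool) (z : ι → 𝔻) (x : ι → WithLp 2 (Hp × Hm))
    (hx : ∀ i, MemSchurFibre B (b i) (z i) (x i)) (a : ι → ℂ) :
    0 ≤ (∑ i ∈ s, ∑ j ∈ s,
      conj (a i) * a j * schurKernel B (b i) (b j) (z i) (z j) (x i) (x j)).re := by
  have hc {t : ℂ} (ht : t ∈ ball (0 : ℂ) 1) : ContinuousAt B t :=
    (hB.1.differentiableAt (isOpen_ball.mem_nhds ht)).continuousAt
  -- The dilated function has other fibres, so the vectors move with r: one coordinate is kept, the
  -- other is recomputed from B(r·).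
  let y (r : ℝ) (i : ι) : WithLp 2 (Hp × Hm) :=
    if b i then WithLp.toLp 2 (ContinuousLinearMap.adjoint (B (r * z i)) (x i).snd, (x i).snd)
    else WithLp.toLp 2 ((x i).fst, B (r * conj (z i : ℂ)) (x i).fst)
  have hy1 (i : ι) : Tendsto (fun r => (y r i).fst) (𝓝[<] 1) (𝓝 (x i).fst) := by
    have hxi := hx i
    simp only [y]
    cases hb : b i
    · simp
    · simp only [MemSchurFibre, hb, if_true] at hxi ⊢
      rw [hxi]
      exact tendsto_clm_apply ((LinearIsometryEquiv.continuous _).continuousAt.tendsto.comp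
        (tendsto_dilate (hc (z i).coe_mem_ball))) tendsto_const_nhds
  have hy2 (i : ι) : Tendsto (fun r => (y r i).snd) (𝓝[<] 1) (𝓝 (x i).snd) := by
    have hxi := hx i
    simp only [y]
    cases hb : b i
    · simp only [MemSchurFibre, hb, Bool.false_eq_true, if_false] at hxi ⊢
      rw [hxi]
      exact tendsto_clm_apply (tendsto_dilate (hc (z i).conj_coe_mem_ball)) tendsto_const_nhds
    · simp
  have hlim (i j : ι) : Tendsto (fun r : ℝ => schurKernel (fun t => B (r * t)) (b i) (b j)
      (z i) (z j) (y r i) (y r j)) (𝓝[<] 1)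
      (𝓝 (schurKernel B (b i) (b j) (z i) (z j) (x i) (x j))) := by
    cases b i <;> cases b j <;> simp only [schurKernel]
    · exact (((hy1 i).inner (hy1 j)).sub ((hy2 i).inner (hy2 j))).div_const _
    · exact (tendsto_clm_apply (tendsto_dslope_dilate hB.1 (z i).conj_coe_mem_ball
        (z j).coe_mem_ball) (hy1 i)).inner (hy2 j)
    · exact (hy2 i).inner (tendsto_clm_apply (tendsto_dslope_dilate hB.1 (z j).conj_coe_mem_ball
        (z i).coe_mem_ball) (hy1 j))
    · exact (((hy2 i).inner (hy2 j)).sub ((hy1 i).inner (hy1 j))).div_const _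
  have hsum : Tendsto (fun r : ℝ => (∑ i ∈ s, ∑ j ∈ s, conj (a i) * a j *
      schurKernel (fun t => B (r * t)) (b i) (b j) (z i) (z j) (y r i) (y r j)).re) (𝓝[<] 1)
      (𝓝 (∑ i ∈ s, ∑ j ∈ s,
        conj (a i) * a j * schurKernel B (b i) (b j) (z i) (z j) (x i) (x j)).re) :=
    (continuous_re.tendsto _).comp (tendsto_finsetSum _ fun i _ => tendsto_finsetSum _ fun j _ =>
      (hlim i j).const_mul _)
  refine ge_of_tendsto hsum ?_
  filter_upwards [Ioo_mem_nhdsLT (zero_lt_one (α := ℝ))] with r hr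
  have hmem {t : ℂ} (ht : t ∈ closedBall (0 : ℂ) 1) : (r : ℂ) * t ∈ ball (0 : ℂ) 1 := by
    simp only [mem_closedBall, dist_zero_right, mem_ball, norm_mul, norm_real, Real.norm_eq_abs,
      abs_of_pos hr.1] at ht ⊢
    nlinarith [hr.1, hr.2]
  refine re_schurKernel_sum_nonneg_of_closedBall s (B := fun t => B (r * t)) ?_ ?_ b _
    (fun i => (z i).norm_lt_one) _ (fun i => ?_) a
  · exact hB.1.comp (by fun_prop) fun t ht => hmem ht
  · intro t ht
    exact (hB.2 ⟨r * t, hmem (sphere_subset_closedBall ht)⟩).le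
  · simp only [y, MemSchurFibre]
    cases b i <;> simp

end PositivityLimit

/-! ### Positivity of the kernel on the total space. -/

section PosSemidef

variable {H : Type*} [NormedAddCommGroup H] [InnerProductSpace ℂ H] [CompleteSpace H]
  {ω : H →ₗ[ℂ] H →ₗ⋆[ℂ] ℂ} {N : 𝔻 → Submodule ℂ H}

/-- The kernel of a Nevanlinna disc is positive. -/
theorem posSemidef_sectionKernel (hω : IsStrongSymplectic ω) (hN : IsNevanlinnaDisc ω N) :
    (sectionKernel ω N).PosSemidef := by
  have : CompleteSpace (N 0) := (hN.1 0).1.completeSpace_coe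
  have : CompleteSpace (sympOrth ω (N 0)) := (hω.isClosed_sympOrth _).completeSpace_coe
  obtain ⟨Ψ, B, h, -⟩ := hN.exists_standardRepresentation hω
  have hK (s t : TotalSpace ω N) (c : ℂ) : sectionKernel ω N s t c =
      schurKernel B s.1.1 t.1.1 s.1.2 t.1.2 (Ψ s.2) (Ψ t.2) * c := by
    rw [← h.kernelPairing_eq hω hN]
    simp [sectionKernel]
  have htfae := (RKHS.posSemidef_tfae (K := sectionKernel ω N)).out 0 2
  refine htfae.2 ⟨?_, fun v => ?_⟩
  · ext s t
    rw [Matrix.conjTranspose_apply, ContinuousLinearMap.star_eq_adjoint]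
    refine ext_inner_left ℂ fun c => ?_
    rw [ContinuousLinearMap.adjoint_inner_right, hK, hK]
    simp only [RCLike.inner_apply, map_mul, schurKernel_conj]
    ring
  · have hpos := re_schurKernel_sum_nonneg v.support h.2.1 (fun s : TotalSpace ω N => s.1.1)
      (fun s => s.1.2) (fun s => Ψ s.2) (fun s => ?_) v
    · refine hpos.trans_eq ?_
      rw [RCLike.re_eq_complex_re]
      congr 1
      refine Finset.sum_congr rfl fun s _ => Finset.sum_congr rfl fun t _ => ?_
      simp only [hK, RCLike.inner_apply, map_mul, schurKernel_conj]
      ring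
    · obtain ⟨⟨_ | _, z⟩, x⟩ := s
      · simpa [MemSchurFibre] using (h.mem_dualFibre_false z _).1 x.2
      · simpa [MemSchurFibre] using (h.mem_dualFibre_true z _).1 x.2

end PosSemidef

/-! ### Transport along symplectic isomorphisms -/

section Transport

/-- Stated for seminormed spaces because 𝔄^{⊥ₛ}/𝔄 enters only with its quotient seminorm. -/
lemma DifferentiableOn.continuousLinearMap_comp_left {E F G : Type*} [SeminormedAddCommGroup E]
    [NormedSpace ℂ E] [SeminormedAddCommGroup F] [NormedSpace ℂ F] [SeminormedAddCommGroup G]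
    [NormedSpace ℂ G] (T : F →L[ℂ] G) {f : E → F} {s : Set E} (hf : DifferentiableOn ℂ f s) :
    DifferentiableOn ℂ (fun x => T (f x)) s := by
  intro x hx
  obtain ⟨f', hf'⟩ := hf x hx
  refine ⟨T ∘L f', ?_⟩
  rw [hasFDerivWithinAt_iff_isLittleO] at hf' ⊢
  refine Asymptotics.IsBigO.trans_isLittleO ?_ hf'
  simpa [Function.comp_def] using T.isBigO_comp (fun y => f y - f x - f' (y - x)) (𝓝[s] x)

variable {H H' : Type*} [SeminormedAddCommGroup H] [NormedSpace ℂ H] [SeminormedAddCommGroup H']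
  [NormedSpace ℂ H'] {ω : H →ₗ[ℂ] H →ₗ⋆[ℂ] ℂ} {ω' : H' →ₗ[ℂ] H' →ₗ⋆[ℂ] ℂ} {Φ : H ≃L[ℂ] H'}

lemma IsSymplecticIso.symm (h : IsSymplecticIso ω ω' Φ) : IsSymplecticIso ω' ω Φ.symm := by
  intro x y
  rw [← h]
  simp

lemma IsSymplecticIso.isStrongSymplectic (h : IsSymplecticIso ω ω' Φ)
    (hω' : IsStrongSymplectic ω') : IsStrongSymplectic ω where
  continuous := by
    simp only [← h _ _]
    exact hω'.continuous.comp
      (by fun_prop : Continuous fun p : H × H => (Φ p.1, Φ p.2))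
  skew x y := by rw [← h, hω'.skew, h]
  nondegenerate x hx := by
    have : Φ x = 0 := hω'.nondegenerate _ fun y => by
      rw [← Φ.apply_symm_apply y, h, hx]
    simpa using this
  surjective φ := by
    obtain ⟨x, hx⟩ := hω'.surjective (φ ∘L (Φ.symm : H' →L[ℂ] H))
    refine ⟨Φ.symm x, fun y => ?_⟩
    rw [← h, Φ.apply_symm_apply, ← hx]
    simp

lemma IsSymplecticIso.map_mem_WPlus (h : IsSymplecticIso ω ω' Φ) {L : Submodule ℂ H}
    (hL : L ∈ WPlus ω) : L.map (Φ : H →ₗ[ℂ] H') ∈ WPlus ω' := by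
  obtain ⟨hcl, hpos, hmax, c, hc, hbd⟩ := hL
  -- The constant comes from ‖Φx‖ ≤ (‖Φ‖ + 1)‖x‖.
  refine ⟨?_, ?_, fun M hM hLM => ?_, c / (‖(Φ : H →L[ℂ] H')‖ + 1) ^ 2, by positivity, ?_⟩
  · have := Φ.toHomeomorph.isClosedMap _ hcl
    simpa using this
  · rintro _ ⟨x, hx, rfl⟩ hx0
    have hx0' : x ≠ 0 := by rintro rfl; simp at hx0
    exact (hpos x hx hx0').trans_eq (by rw [← h x x]; rfl)
  · have hM' : M.comap (Φ : H →ₗ[ℂ] H') = L := by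
      refine hmax _ (fun x hx hx0 => ?_) (Submodule.map_le_iff_le_comap.1 hLM)
      rw [← h x x]
      exact hM _ hx (by simpa using hx0)
    rw [← hM']
    refine (Submodule.map_comap_eq_of_surjective ?_ M).symm
    exact Φ.surjective
  · rintro _ ⟨x, hx, rfl⟩
    have h1 := hbd x hx
    rw [← h x x] at h1
    refine le_trans ?_ h1
    rw [div_mul_eq_mul_div, div_le_iff₀ (by positivity), mul_assoc, ← mul_pow]
    gcongr
    refine ((Φ : H →L[ℂ] H').le_opNorm x).trans ?_
    nlinarith [norm_nonneg x]

/-- A family of subspaces congruent to a Nevanlinna disc is a Nevanlinna disc. -/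
theorem IsSymplecticIso.isNevanlinnaDisc (h : IsSymplecticIso ω ω' Φ) {N : 𝔻 → Submodule ℂ H}
    {N' : 𝔻 → Submodule ℂ H'} (hNN' : ∀ z, Φ '' (N z : Set H) = (N' z : Set H'))
    (hN' : IsNevanlinnaDisc ω' N') : IsNevanlinnaDisc ω N := by
  have hmem (z : 𝔻) (x : H) : x ∈ N z ↔ Φ x ∈ N' z := by
    rw [← SetLike.mem_coe (p := N' z), ← hNN']
    exact (Φ.injective.mem_set_image).symm
  refine ⟨fun z => ?_, fun L hL => ?_⟩
  · convert h.symm.map_mem_WPlus (hN'.1 z)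
    ext x
    rw [hmem, Submodule.mem_map]
    constructor
    · exact fun hx => ⟨_, hx, Φ.symm_apply_apply x⟩
    · rintro ⟨y, hy, rfl⟩
      simpa using hy
  · have hmap := h.map_mem_WPlus hL
    generalize hLL' : L.map (Φ : H →ₗ[ℂ] H') = L' at hmap
    obtain ⟨B, hB, hNB⟩ := hN'.2 _ hmap
    have hL' (x : H) : Φ x ∈ L' ↔ x ∈ L := by
      rw [← hLL']
      constructor
      · rintro ⟨y, hy, hyx⟩
        rwa [← Φ.injective hyx]
      · exact fun hx => ⟨x, hx, rfl⟩
    -- The chart at L is obtained from the chart at L' = Φ(L) by B ↦ e₂Be₁, which is bounded and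
    -- linear, so holomorphy is preserved.
    let e₁ : L →L[ℂ] L' := ((Φ : H →L[ℂ] H') ∘L L.subtypeL).codRestrict L'
      fun x => (hL' x).2 x.2
    let e₂ : sympOrth ω' L' →L[ℂ] sympOrth ω L :=
      ((Φ.symm : H' →L[ℂ] H) ∘L (sympOrth ω' L').subtypeL).codRestrict (sympOrth ω L)
        fun x y hy => by
          rw [← h]
          simpa using x.2 _ ((hL' y).2 hy)
    have he₂ (v : sympOrth ω' L') : Φ (e₂ v : H) = v := Φ.apply_symm_apply _
    refine ⟨fun z => e₂ ∘L B z ∘L e₁, ?_, fun z => ?_⟩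
    · exact (hB.continuousLinearMap_comp_left
        ((ContinuousLinearMap.compL ℂ L' (sympOrth ω' L') (sympOrth ω L)) e₂)).continuousLinearMap_comp_left
        ((ContinuousLinearMap.compL ℂ L L' (sympOrth ω L)).flip e₁)
    · ext x
      rw [SetLike.mem_coe, hmem, ← SetLike.mem_coe, hNB]
      constructor
      · rintro ⟨⟨y', hy'⟩, hxy⟩
        obtain ⟨y, rfl⟩ := Φ.surjective y'
        refine ⟨⟨y, (hL' y).1 hy'⟩, Φ.injective ?_⟩
        rw [hxy, map_add]
        exact congrArg _ (he₂ _).symm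
      · rintro ⟨y, rfl⟩
        refine ⟨e₁ y, ?_⟩
        rw [map_add]
        exact congrArg _ (he₂ _)

end Transport

/-! ### The model -/

section Model

variable {H : Type*} [NormedAddCommGroup H] [InnerProductSpace ℂ H] [CompleteSpace H]
  {ω : H →ₗ[ℂ] H →ₗ⋆[ℂ] ℂ} {N : 𝔻 → Submodule ℂ H}

lemma one_sub_mul_kernelPairing (hω : IsStrongSymplectic ω) (hN : IsNevanlinnaDisc ω N)
    (b : Bool) (z w : 𝔻) (x : dualFibre ω N (b, w)) (η : dualFibre ω N (b, z)) :
    (1 - (z : ℂ) * conj (w : ℂ)) * kernelPairing ω N (b, z) (b, w) x η =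
      (if b then I else -I) * ω x η := by
  have h0 : 1 - (z : ℂ) * conj (w : ℂ) ≠ 0 :=
    one_sub_mul_ne_zero z.norm_lt_one (by simpa using w.norm_lt_one.le)
  simp only [kernelPairing, if_true, kernelQ_eq hω hN]
  field_simp

/-- Cleared of its denominator the identity survives at z = w̄, where the two fibres are orthogonal
and both sides vanish; the limit value of K plays no role. -/
lemma sub_mul_kernelPairing (hω : IsStrongSymplectic ω) (hN : IsNevanlinnaDisc ω N)
    (b : Bool) (z w : 𝔻) (x : dualFibre ω N (!b, w)) (η : dualFibre ω N (b, z)) :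
    ((z : ℂ) - conj (w : ℂ)) * kernelPairing ω N (b, z) (!b, w) x η =
      -((if b then I else -I) * ω x η) := by
  by_cases hzw : z = star w
  · have h0 : (z : ℂ) - conj (w : ℂ) = 0 := by simp [hzw]
    have h1 : ω x η = 0 := dualFibre_orthogonal hω x.2 (by
      have := η.2
      simpa [TwoDiscs.conj, hzw] using this)
    rw [h0, h1]
    simp
  · have h0 : (z : ℂ) - conj (w : ℂ) ≠ 0 :=
      sub_ne_zero.2 fun h => hzw (UnitDisc.coe_injective h)
    have hb : ¬ b = !b := by cases b <;> simp
    simp only [kernelPairing, hb, hzw, if_false, kernelQ_eq hω hN]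
    field_simp

/-- Vectors of a fibre over `0` are limits of vectors of the fibres over `z → 0`. -/
lemma exists_section_tendsto (hω : IsStrongSymplectic ω) (hN : IsNevanlinnaDisc ω N) (b : Bool)
    (x : dualFibre ω N (b, 0)) :
    ∃ y : ∀ z : 𝔻, dualFibre ω N (b, z),
      Tendsto (fun z => (y z : H)) (𝓝[≠] 0) (𝓝 (x : H)) := by
  have : CompleteSpace (N 0) := (hN.1 0).1.completeSpace_coe
  have : CompleteSpace (sympOrth ω (N 0)) := (hω.isClosed_sympOrth _).completeSpace_coe
  obtain ⟨Ψ, B, h, -⟩ := hN.exists_standardRepresentation hω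
  have hcoord {u : 𝔻 → N 0} {v : 𝔻 → sympOrth ω (N 0)}
      (hu : Tendsto u (𝓝[≠] 0) (𝓝 (Ψ x).fst)) (hv : Tendsto v (𝓝[≠] 0) (𝓝 (Ψ x).snd)) :
      Tendsto (fun z => Ψ.symm (WithLp.toLp 2 (u z, v z))) (𝓝[≠] 0) (𝓝 (x : H)) := by
    have h1 := ((WithLp.prodContinuousLinearEquiv 2 ℂ (N 0) (sympOrth ω (N 0))).symm.trans
      Ψ.symm).continuous.tendsto ((Ψ x).fst, (Ψ x).snd)
    have h2 := h1.comp (hu.prodMk_nhds hv)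
    have h3 : Ψ.symm (WithLp.toLp 2 ((Ψ x).fst, (Ψ x).snd)) = x := Ψ.symm_apply_apply x
    rw [← h3]
    exact h2
  cases b
  · refine ⟨fun z => ⟨Ψ.symm (WithLp.toLp 2 ((Ψ x).fst, B (conj (z : ℂ)) (Ψ x).fst)),
      (h.mem_dualFibre_false z _).2 (by simp)⟩, hcoord tendsto_const_nhds ?_⟩
    rw [(h.mem_dualFibre_false 0 _).1 x.2]
    exact tendsto_clm_apply ((h.differentiableAt
      (UnitDisc.conj_coe_mem_ball 0)).continuousAt.tendsto.comp
      ((UnitDisc.tendsto_conj_coe_punctured 0).mono_right nhdsWithin_le_nhds)) tendsto_const_nhds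
  · refine ⟨fun z => ⟨Ψ.symm (WithLp.toLp 2
      (ContinuousLinearMap.adjoint (B z) (Ψ x).snd, (Ψ x).snd)),
      (h.mem_dualFibre_true z _).2 (by simp)⟩, hcoord ?_ tendsto_const_nhds⟩
    rw [(h.mem_dualFibre_true 0 _).1 x.2]
    exact tendsto_clm_apply ((LinearIsometryEquiv.continuous _).continuousAt.tendsto.comp
      ((h.differentiableAt (UnitDisc.coe_mem_ball 0)).continuousAt.tendsto.comp
      ((UnitDisc.tendsto_coe_punctured 0).mono_right nhdsWithin_le_nhds))) tendsto_const_nhds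

variable [hF : Fact (sectionKernel ω N).PosSemidef]

/-- The kernel function of the model space at a point of the total space of `F†`. -/
noncomputable def modelKer (s : TotalSpace ω N) : ModelSpace ω N :=
  RKHS.kerFun (ModelSpace ω N) s (1 : ℂ)

omit [CompleteSpace H] in
lemma inner_modelKer (s : TotalSpace ω N) (f : ModelSpace ω N) :
    inner ℂ (modelKer s) f = f s := by
  rw [modelKer, RKHS.kerFun_inner]
  simp

omit [CompleteSpace H] in
lemma modelKer_apply (s t : TotalSpace ω N) :
    modelKer t s = kernelPairing ω N s.1 t.1 t.2 s.2 := by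
  rw [modelKer, RKHS.kerFun_apply, RKHS.OfKernel.kernel_ofKernel]
  simp [sectionKernel]

/-- The kernel functions depend linearly on the vector of the fibre. -/
lemma exists_modelKer_linear (hω : IsStrongSymplectic ω) (hN : IsNevanlinnaDisc ω N)
    (p : TwoDiscs) :
    ∃ κ : dualFibre ω N p →ₗ[ℂ] ModelSpace ω N, ∀ x, κ x = modelKer ⟨p, x⟩ := by
  have : CompleteSpace (N 0) := (hN.1 0).1.completeSpace_coe
  have : CompleteSpace (sympOrth ω (N 0)) := (hω.isClosed_sympOrth _).completeSpace_coe
  obtain ⟨Ψ, B, h, -⟩ := hN.exists_standardRepresentation hω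
  refine ⟨{ toFun := fun x => modelKer ⟨p, x⟩, map_add' := fun x y => ?_,
            map_smul' := fun c x => ?_ }, fun x => rfl⟩
  · ext s
    simp only [RKHS.coe_add, Pi.add_apply, modelKer_apply, h.kernelPairing_eq hω hN,
      Submodule.coe_add, map_add, schurKernel_add_right]
  · ext s
    simp only [RKHS.coe_smul, Pi.smul_apply, modelKer_apply, h.kernelPairing_eq hω hN,
      Submodule.coe_smul, map_smul, schurKernel_smul_right, RingHom.id_apply, smul_eq_mul]

/-- An element of the model space that vanishes on the fibres over `z ≠ 0` vanishes over `0`. -/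
lemma apply_zero_eq_zero (hω : IsStrongSymplectic ω) (hN : IsNevanlinnaDisc ω N) (b : Bool)
    (f : ModelSpace ω N)
    (hf : ∀ (z : 𝔻), z ≠ 0 → ∀ x : dualFibre ω N (b, z), f ⟨(b, z), x⟩ = 0)
    (x : dualFibre ω N (b, 0)) : f ⟨(b, 0), x⟩ = 0 := by
  obtain ⟨y, hy⟩ := exists_section_tendsto hω hN b x
  set c : ℂ := if b then I else -I
  have hpair {u v : 𝔻 → H} {u₀ v₀ : H} (hu : Tendsto u (𝓝[≠] 0) (𝓝 u₀))
      (hv : Tendsto v (𝓝[≠] 0) (𝓝 v₀)) :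
      Tendsto (fun z => c * ω (u z) (v z)) (𝓝[≠] 0) (𝓝 (c * ω u₀ v₀)) :=
    ((hω.continuous.tendsto (u₀, v₀)).comp (hu.prodMk_nhds hv)).const_mul c
  have hK (z w : 𝔻) (u : dualFibre ω N (b, w)) (v : dualFibre ω N (b, z)) :
      inner ℂ (modelKer ⟨(b, z), v⟩) (modelKer ⟨(b, w), u⟩) =
        c * ω u v / (1 - (z : ℂ) * conj (w : ℂ)) := by
    have h0 : 1 - (z : ℂ) * conj (w : ℂ) ≠ 0 :=
      one_sub_mul_ne_zero z.norm_lt_one (by simpa using w.norm_lt_one.le)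
    rw [inner_modelKer, modelKer_apply, eq_div_iff h0, mul_comm]
    exact one_sub_mul_kernelPairing hω hN b z w u v
  have hz : Tendsto (fun z : 𝔻 => 1 - (z : ℂ) * conj (z : ℂ)) (𝓝[≠] 0) (𝓝 1) := by
    have h1 : Continuous fun z : 𝔻 => 1 - (z : ℂ) * conj (z : ℂ) := by
      have := UnitDisc.continuous_coe
      fun_prop
    exact (h1.tendsto' 0 1 (by simp)).mono_left nhdsWithin_le_nhds
  -- Within one copy of the disc 1 - z w̄ never vanishes, so the four terms of the squared norm
  -- converge and their limits cancel: the kernel functions converge in norm.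
  have hnorm : Tendsto (fun z => ‖modelKer ⟨(b, z), y z⟩ - modelKer ⟨(b, 0), x⟩‖ ^ 2) (𝓝[≠] 0)
      (𝓝 0) := by
    have h1 : Tendsto (fun z => inner ℂ (modelKer ⟨(b, z), y z⟩ - modelKer ⟨(b, 0), x⟩)
        (modelKer ⟨(b, z), y z⟩ - modelKer ⟨(b, 0), x⟩)) (𝓝[≠] 0) (𝓝 (0 : ℂ)) := by
      simp only [inner_sub_left, inner_sub_right, hK]
      have hx : Tendsto (fun _ : 𝔻 => (x : H)) (𝓝[≠] 0) (𝓝 (x : H)) := tendsto_const_nhds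
      have h2 := (((hpair hy hy).div hz one_ne_zero).sub (hpair hx hy)).sub
        ((hpair hy hx).sub (hpair hx hx))
      simp only [div_one, sub_self] at h2
      refine h2.congr fun z => ?_
      simp
      ring
    have h3 := (continuous_re.tendsto _).comp h1
    refine h3.congr fun z => ?_
    exact inner_self_eq_norm_sq (𝕜 := ℂ) _
  have hlim : Tendsto (fun z => modelKer ⟨(b, z), y z⟩) (𝓝[≠] 0) (𝓝 (modelKer ⟨(b, 0), x⟩)) := by
    rw [tendsto_iff_norm_sub_tendsto_zero]
    have := hnorm.sqrt
    simpa using this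
  have h0 : Tendsto (fun z => inner ℂ (modelKer ⟨(b, z), y z⟩) f) (𝓝[≠] 0) (𝓝 (0 : ℂ)) := by
    refine tendsto_const_nhds.congr' ?_
    filter_upwards [self_mem_nhdsWithin] with z hz
    rw [inner_modelKer, hf z hz]
  have := tendsto_nhds_unique (hlim.inner (tendsto_const_nhds (x := f))) h0
  rwa [inner_modelKer] at this

/-- The element of the defect space `N_{λ̄}` of the model relation attached to a vector of
`F†_λ`. -/
noncomputable def defectVector (s : TotalSpace ω N) :
    WithLp 2 (ModelSpace ω N × ModelSpace ω N) :=
  if s.1.1 then WithLp.toLp 2 (conj (s.1.2 : ℂ) • modelKer s, modelKer s)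
  else WithLp.toLp 2 (modelKer s, conj (s.1.2 : ℂ) • modelKer s)

/-- The coefficients λ̄ of the defect vectors produce the factors 1 - λμ̄ and λ - μ̄, which cancel
the denominators of K. This identity is what recovers `ω` from the model. -/
lemma modelForm_defectVector (hω : IsStrongSymplectic ω) (hN : IsNevanlinnaDisc ω N)
    (s t : TotalSpace ω N) : modelForm ω N (defectVector t) (defectVector s) = ω t.2 s.2 := by
  obtain ⟨⟨b, z⟩, η⟩ := s
  obtain ⟨⟨c, w⟩, x⟩ := t
  rw [stdForm_apply]
  cases b <;> cases c <;>
    simp only [defectVector, if_true, Bool.false_eq_true, if_false, WithLp.toLp_fst,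
      WithLp.toLp_snd, inner_smul_left, inner_smul_right, inner_modelKer, modelKer_apply,
      Complex.conj_conj]
  · have := one_sub_mul_kernelPairing hω hN false z w x η
    simp only [Bool.false_eq_true, if_false] at this
    linear_combination I * this - ω x η * I_mul_I
  · have : ((z : ℂ) - conj (w : ℂ)) * kernelPairing ω N (false, z) (true, w) x η =
        -(-I * ω x η) := sub_mul_kernelPairing hω hN false z w x η
    linear_combination -I * this - ω x η * I_mul_I
  · have : ((z : ℂ) - conj (w : ℂ)) * kernelPairing ω N (true, z) (false, w) x η =
        -(I * ω x η) := sub_mul_kernelPairing hω hN true z w x η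
    linear_combination I * this - ω x η * I_mul_I
  · have := one_sub_mul_kernelPairing hω hN true z w x η
    simp only [if_true] at this
    linear_combination -I * this - ω x η * I_mul_I

omit [CompleteSpace H] in
/-- The model relation is the symplectic complement of the defect vectors. -/
lemma mem_modelRelation_iff (a : WithLp 2 (ModelSpace ω N × ModelSpace ω N)) :
    a ∈ modelRelation ω N ↔ ∀ s, modelForm ω N a (defectVector s) = 0 := by
  have h1 (z : 𝔻) (η : dualFibre ω N (true, z)) :
      modelForm ω N a (defectVector ⟨(true, z), η⟩) = 0 ↔
        a.snd ⟨(true, z), η⟩ = (z : ℂ) * a.fst ⟨(true, z), η⟩ := by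
    rw [stdForm_apply]
    simp only [defectVector, if_true, WithLp.toLp_fst, WithLp.toLp_snd, inner_smul_left,
      inner_modelKer, Complex.conj_conj, ← mul_sub, mul_eq_zero, I_ne_zero, false_or, sub_eq_zero]
    exact eq_comm
  have h2 (z : 𝔻) (η : dualFibre ω N (false, z)) :
      modelForm ω N a (defectVector ⟨(false, z), η⟩) = 0 ↔
        a.fst ⟨(false, z), η⟩ = (z : ℂ) * a.snd ⟨(false, z), η⟩ := by
    rw [stdForm_apply]
    simp only [defectVector, Bool.false_eq_true, if_false, WithLp.toLp_fst, WithLp.toLp_snd,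
      inner_smul_left, inner_modelKer, Complex.conj_conj, ← mul_sub, mul_eq_zero, I_ne_zero,
      false_or, sub_eq_zero]
  constructor
  · rintro ⟨ha, ha'⟩ ⟨⟨_ | _, z⟩, η⟩
    · exact (h2 z η).2 (ha' z η)
    · exact (h1 z η).2 (ha z η)
  · intro h
    exact ⟨fun z η => (h1 z η).1 (h _), fun z η => (h2 z η).1 (h _)⟩

omit [CompleteSpace H] in
lemma modelForm_isStrongSymplectic : IsStrongSymplectic (modelForm ω N) :=
  stdForm_isStrongSymplectic _ _

omit [CompleteSpace H] in
lemma isClosed_modelRelation :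
    IsClosed (modelRelation ω N : Set (WithLp 2 (ModelSpace ω N × ModelSpace ω N))) := by
  have : (modelRelation ω N : Set (WithLp 2 (ModelSpace ω N × ModelSpace ω N))) =
      sympOrth (modelForm ω N) (Submodule.span ℂ (Set.range defectVector)) := by
    ext a
    rw [SetLike.mem_coe, mem_modelRelation_iff, SetLike.mem_coe, mem_sympOrth]
    constructor
    · intro h y hy
      induction hy using Submodule.span_induction with
      | mem y hy => obtain ⟨s, rfl⟩ := hy; exact h s
      | zero => simp
      | add x y _ _ hx hy => rw [map_add, hx, hy, add_zero]
      | smul c x _ hx => simp [hx]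
    · exact fun h s => h _ (Submodule.subset_span ⟨s, rfl⟩)
  rw [this]
  exact modelForm_isStrongSymplectic.isClosed_sympOrth _

omit [CompleteSpace H] in
lemma defectVector_mem_sympOrth (s : TotalSpace ω N) :
    defectVector s ∈ sympOrth (modelForm ω N) (modelRelation ω N) := fun a ha =>
  modelForm_isStrongSymplectic.eq_zero_comm.1 ((mem_modelRelation_iff a).1 ha s)

omit [CompleteSpace H] in
lemma defectVector_mem_universalWeyl (p : TwoDiscs) (x : dualFibre ω N p.conj) :
    defectVector (⟨p.conj, x⟩ : TotalSpace ω N) ∈ universalWeyl (ModelSpace ω N) p := by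
  obtain ⟨_ | _, z⟩ := p <;>
  · change _ = _
    simp [defectVector, TwoDiscs.conj]

end Model

/-! ### Embedding of H₊ ⊕ H₋ by the defect vectors over 0. -/

section ModelIso

variable {H : Type*} [NormedAddCommGroup H] [InnerProductSpace ℂ H] [CompleteSpace H]
  {ω : H →ₗ[ℂ] H →ₗ⋆[ℂ] ℂ} {N : 𝔻 → Submodule ℂ H}
  {Hp Hm : Type*} [NormedAddCommGroup Hp] [InnerProductSpace ℂ Hp] [CompleteSpace Hp]
  [NormedAddCommGroup Hm] [InnerProductSpace ℂ Hm] [CompleteSpace Hm]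
  {Ψ : H ≃L[ℂ] WithLp 2 (Hp × Hm)} {B : ℂ → (Hp →L[ℂ] Hm)}

omit [CompleteSpace H] [CompleteSpace Hp] [CompleteSpace Hm] in
lemma IsStandardRepresentation.symm_fst_mem (h : IsStandardRepresentation ω N Ψ B)
    (hB0 : B 0 = 0) (x : Hp) :
    Ψ.symm (WithLp.toLp 2 (x, 0)) ∈ dualFibre ω N (false, 0) := by
  rw [h.mem_dualFibre_false]
  simp [hB0]

omit [CompleteSpace H] in
lemma IsStandardRepresentation.symm_snd_mem (h : IsStandardRepresentation ω N Ψ B)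
    (hB0 : B 0 = 0) (x : Hm) :
    Ψ.symm (WithLp.toLp 2 (0, x)) ∈ dualFibre ω N (true, 0) := by
  rw [h.mem_dualFibre_true]
  simp [hB0]

variable [hF : Fact (sectionKernel ω N).PosSemidef]

/-- The kernel functions over the points `0` of the two discs embed `H₊` and `H₋`
isometrically. -/
lemma IsStandardRepresentation.exists_isometries (hω : IsStrongSymplectic ω)
    (hN : IsNevanlinnaDisc ω N) (h : IsStandardRepresentation ω N Ψ B) (hB0 : B 0 = 0) :
    ∃ (κp : Hp →ₗᵢ[ℂ] ModelSpace ω N) (κm : Hm →ₗᵢ[ℂ] ModelSpace ω N),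
      (∀ x, κp x = modelKer ⟨(false, 0), ⟨_, h.symm_fst_mem hB0 x⟩⟩) ∧
      (∀ x, κm x = modelKer ⟨(true, 0), ⟨_, h.symm_snd_mem hB0 x⟩⟩) := by
  have hnorm {p : TwoDiscs} {x : dualFibre ω N p} {r : ℝ} (hr : 0 ≤ r)
      (hx : kernelPairing ω N p p x x = (r : ℂ) ^ 2) :
      ‖(modelKer ⟨p, x⟩ : ModelSpace ω N)‖ = r := by
    rw [← sq_eq_sq₀ (norm_nonneg _) hr, ← inner_self_eq_norm_sq (𝕜 := ℂ), inner_modelKer,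
      modelKer_apply, hx, RCLike.re_eq_complex_re, ← ofReal_pow, ofReal_re]
  obtain ⟨κ, hκ⟩ := exists_modelKer_linear hω hN (false, 0)
  obtain ⟨κ', hκ'⟩ := exists_modelKer_linear hω hN (true, 0)
  refine ⟨⟨{ toFun := fun x => κ ⟨_, h.symm_fst_mem hB0 x⟩
             map_add' := fun x y => ?_
             map_smul' := fun c x => ?_ }, fun x => ?_⟩,
          ⟨{ toFun := fun x => κ' ⟨_, h.symm_snd_mem hB0 x⟩
             map_add' := fun x y => ?_
             map_smul' := fun c x => ?_ }, fun x => ?_⟩, fun x => hκ _, fun x => hκ' _⟩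
  · rw [← map_add]
    congr 1
    ext
    simp [← map_add, ← WithLp.toLp_add]
  · rw [RingHom.id_apply, ← map_smul]
    congr 1
    ext
    simp [← map_smul, ← WithLp.toLp_smul]
  · simp only [LinearMap.coe_mk, AddHom.coe_mk, hκ]
    refine hnorm (norm_nonneg _) ?_
    -- At 0 the denominator is 1, and on a vector (x, 0) the kernel is the squared norm of x.
    rw [h.kernelPairing_eq hω hN]
    simp [schurKernel, inner_self_eq_norm_sq_to_K]
  · rw [← map_add]
    congr 1
    ext
    simp [← map_add, ← WithLp.toLp_add]
  · rw [RingHom.id_apply, ← map_smul]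
    congr 1
    ext
    simp [← map_smul, ← WithLp.toLp_smul]
  · simp only [LinearMap.coe_mk, AddHom.coe_mk, hκ']
    refine hnorm (norm_nonneg _) ?_
    rw [h.kernelPairing_eq hω hN]
    simp [schurKernel, inner_self_eq_norm_sq_to_K]

/-- `T` is a symplectic embedding of the standard space `H₊ ⊕ H₋` into `𝔥 ⊕ 𝔥`, spanned by defect
vectors, and `R` is its symplectic adjoint. -/
structure IsModelEmbedding (Ψ : H ≃L[ℂ] WithLp 2 (Hp × Hm))
    (κp : Hp →ₗᵢ[ℂ] ModelSpace ω N) (κm : Hm →ₗᵢ[ℂ] ModelSpace ω N)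
    (T : WithLp 2 (Hp × Hm) →L[ℂ] WithLp 2 (ModelSpace ω N × ModelSpace ω N))
    (R : WithLp 2 (ModelSpace ω N × ModelSpace ω N) →L[ℂ] WithLp 2 (Hp × Hm)) : Prop where
  apply_eq : ∀ a, T a = WithLp.toLp 2 (κp a.fst, κm a.snd)
  adjoint_eq : ∀ a, R a = WithLp.toLp 2
    (ContinuousLinearMap.adjoint κp.toContinuousLinearMap a.fst,
      ContinuousLinearMap.adjoint κm.toContinuousLinearMap a.snd)
  modelForm_right : ∀ a b, modelForm ω N b (T a) = stdForm Hp Hm (R b) a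
  adjoint_apply : ∀ a, R (T a) = a
  modelForm_defectVector : ∀ a s, modelForm ω N (T a) (defectVector s) = ω (Ψ.symm a) s.2
  orthogonal : ∀ a ∈ modelRelation ω N, ∀ b, modelForm ω N a (T b) = 0

omit hF in
lemma LinearIsometry.adjoint_apply_apply {E F : Type*} [NormedAddCommGroup E]
    [InnerProductSpace ℂ E] [CompleteSpace E] [NormedAddCommGroup F] [InnerProductSpace ℂ F]
    [CompleteSpace F] (κ : E →ₗᵢ[ℂ] F) (x : E) :
    ContinuousLinearMap.adjoint κ.toContinuousLinearMap (κ x) = x :=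
  ext_inner_left ℂ fun y => by
    rw [ContinuousLinearMap.adjoint_inner_right]
    exact κ.inner_map_map y x

/-- Over λ = 0 each defect vector has only one nonzero component, so T a is a sum of two defect
vectors, one from each disc; their product formula and their orthogonality to 𝔄 carry over to T. -/
lemma IsStandardRepresentation.exists_isModelEmbedding (hω : IsStrongSymplectic ω)
    (hN : IsNevanlinnaDisc ω N) (h : IsStandardRepresentation ω N Ψ B) (hB0 : B 0 = 0) :
    ∃ (κp : Hp →ₗᵢ[ℂ] ModelSpace ω N) (κm : Hm →ₗᵢ[ℂ] ModelSpace ω N)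
      (T : WithLp 2 (Hp × Hm) →L[ℂ] WithLp 2 (ModelSpace ω N × ModelSpace ω N))
      (R : WithLp 2 (ModelSpace ω N × ModelSpace ω N) →L[ℂ] WithLp 2 (Hp × Hm)),
      IsModelEmbedding Ψ κp κm T R := by
  obtain ⟨κp, κm, hκp, hκm⟩ := h.exists_isometries hω hN hB0
  let e₁ := WithLp.prodContinuousLinearEquiv 2 ℂ Hp Hm
  let e₂ := WithLp.prodContinuousLinearEquiv 2 ℂ (ModelSpace ω N) (ModelSpace ω N)
  let T : WithLp 2 (Hp × Hm) →L[ℂ] WithLp 2 (ModelSpace ω N × ModelSpace ω N) :=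
    (e₂.symm : _ →L[ℂ] _) ∘L
      (κp.toContinuousLinearMap.prodMap κm.toContinuousLinearMap) ∘L (e₁ : _ →L[ℂ] _)
  let R : WithLp 2 (ModelSpace ω N × ModelSpace ω N) →L[ℂ] WithLp 2 (Hp × Hm) :=
    (e₁.symm : _ →L[ℂ] _) ∘L
      ((ContinuousLinearMap.adjoint κp.toContinuousLinearMap).prodMap
        (ContinuousLinearMap.adjoint κm.toContinuousLinearMap)) ∘L (e₂ : _ →L[ℂ] _)
  have hT (a) : T a = WithLp.toLp 2 (κp a.fst, κm a.snd) := rfl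
  have hR (a) : R a = WithLp.toLp 2 (ContinuousLinearMap.adjoint κp.toContinuousLinearMap a.fst,
      ContinuousLinearMap.adjoint κm.toContinuousLinearMap a.snd) := rfl
  have hTd (a) : T a = defectVector ⟨(false, 0), ⟨_, h.symm_fst_mem hB0 a.fst⟩⟩ +
      defectVector ⟨(true, 0), ⟨_, h.symm_snd_mem hB0 a.snd⟩⟩ := by
    rw [hT, hκp, hκm]
    simp [defectVector, ← WithLp.toLp_add]
  refine ⟨κp, κm, T, R, hT, hR, fun a b => ?_, fun a => ?_, fun a s => ?_, fun a ha b => ?_⟩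
  · rw [hT, hR, stdForm_apply, stdForm_apply]
    simp only [WithLp.toLp_fst, WithLp.toLp_snd, ContinuousLinearMap.adjoint_inner_right]
    rfl
  · rw [hR, hT]
    simp only [WithLp.toLp_fst, WithLp.toLp_snd, LinearIsometry.adjoint_apply_apply]
    rfl
  · rw [hTd, map_add, LinearMap.add_apply, modelForm_defectVector hω hN,
      modelForm_defectVector hω hN, ← LinearMap.add_apply, ← map_add]
    simp only [← map_add, ← WithLp.toLp_add, Prod.mk_add_mk, add_zero, zero_add]
    rfl
  · rw [hTd, map_add, (mem_modelRelation_iff a).1 ha, (mem_modelRelation_iff a).1 ha, add_zero]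

end ModelIso

/-! ### Density and norm estimates. -/

section HilbertLemmas

variable {E F : Type*} [NormedAddCommGroup E] [InnerProductSpace ℂ E] [CompleteSpace E]
  [NormedAddCommGroup F] [InnerProductSpace ℂ F] [CompleteSpace F]

/-- The projection 1 - κκ* onto ker κ* preserves orthogonality to D, because D ⊆ ker κ*. So `hker`
forces v = κκ*v for v ⊥ D, whence v ⊥ f, and f lies in the double complement of D. -/
lemma mem_topologicalClosure_of_adjoint_eq_zero {D : Submodule ℂ E} {κ : F →ₗᵢ[ℂ] E}
    (hD : ∀ d ∈ D, ContinuousLinearMap.adjoint κ.toContinuousLinearMap d = 0)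
    (hker : ∀ v ∈ Dᗮ, ContinuousLinearMap.adjoint κ.toContinuousLinearMap v = 0 → v = 0)
    {f : E} (hf : ContinuousLinearMap.adjoint κ.toContinuousLinearMap f = 0) :
    f ∈ D.topologicalClosure := by
  rw [← Submodule.orthogonal_orthogonal_eq_closure, Submodule.mem_orthogonal]
  intro v hv
  set κ' := ContinuousLinearMap.adjoint κ.toContinuousLinearMap
  have hκ (x : F) (y : E) : inner ℂ y (κ x) = inner ℂ (κ' y) x :=
    (ContinuousLinearMap.adjoint_inner_left κ.toContinuousLinearMap x y).symm
  have h1 : v - κ (κ' v) = 0 := by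
    refine hker _ ?_ ?_
    · rw [Submodule.mem_orthogonal]
      intro d hd
      rw [inner_sub_right, (Submodule.mem_orthogonal _ _).1 hv d hd, hκ, hD d hd,
        inner_zero_left, sub_zero]
    · rw [map_sub, LinearIsometry.adjoint_apply_apply, sub_self]
  rw [sub_eq_zero.1 h1, ← inner_conj_symm, hκ, hf, inner_zero_left, map_zero]

omit [CompleteSpace E] in
-- The bound passes to the closure of D and is then applied to d = f.
lemma norm_le_of_mem_topologicalClosure {D : Submodule ℂ E} {f : E} {c : ℝ} (hc : 0 ≤ c)
    (hD : ∀ d ∈ D, ‖inner ℂ d f‖ ≤ ‖d‖ * c) (hf : f ∈ D.topologicalClosure) : ‖f‖ ≤ c := by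
  have hcl : IsClosed {d : E | ‖inner ℂ d f‖ ≤ ‖d‖ * c} :=
    isClosed_le (by fun_prop) (by fun_prop)
  have h1 : ‖inner ℂ f f‖ ≤ ‖f‖ * c := closure_minimal (fun d hd => hD d hd) hcl hf
  have h2 : ‖inner ℂ f f‖ = ‖f‖ * ‖f‖ := by
    rw [inner_self_eq_norm_sq_to_K, norm_pow, RCLike.norm_ofReal, abs_norm, sq]
  rw [h2] at h1
  rcases (norm_nonneg f).eq_or_lt with h0 | h0
  · rwa [← h0]
  · exact le_of_mul_le_mul_left h1 h0

end HilbertLemmas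

lemma stdForm_self {E : Type*} [NormedAddCommGroup E] [InnerProductSpace ℂ E]
    (a : WithLp 2 (E × E)) :
    stdForm E E a a = I * ((‖a.fst‖ ^ 2 - ‖a.snd‖ ^ 2 : ℝ) : ℂ) := by
  rw [stdForm_apply, inner_self_eq_norm_sq_to_K, inner_self_eq_norm_sq_to_K]
  push_cast
  rw [mul_sub]
  rfl

lemma norm_fst_eq_norm_snd {E : Type*} [NormedAddCommGroup E] [InnerProductSpace ℂ E]
    {a : WithLp 2 (E × E)} (ha : stdForm E E a a = 0) : ‖a.fst‖ = ‖a.snd‖ := by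
  rw [stdForm_self, mul_eq_zero, or_iff_right I_ne_zero, ofReal_eq_zero, sub_eq_zero] at ha
  exact (sq_eq_sq₀ (norm_nonneg _) (norm_nonneg _)).1 ha

lemma re_stdForm_self_of_mem_universalWeyl_true {E : Type*} [NormedAddCommGroup E]
    [InnerProductSpace ℂ E] {z : 𝔻} {a : WithLp 2 (E × E)} (ha : a ∈ universalWeyl E (true, z))
    (ha0 : a ≠ 0) : 0 < (-I * stdForm E E a a).re := by
  have h : a.snd = (z : ℂ) • a.fst := ha
  have h0 : a.fst ≠ 0 := fun h0 => ha0 (by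
    apply WithLp.ofLp_injective 2
    exact Prod.ext h0 (by simpa [h0] using h))
  rw [stdForm_self, ← mul_assoc, neg_mul, I_mul_I, neg_neg, one_mul, ofReal_re, h,
    norm_smul, sub_pos]
  have h1 := norm_pos_iff.2 h0
  have h2 := z.norm_lt_one
  exact pow_lt_pow_left₀ (by nlinarith) (by positivity) two_ne_zero

lemma re_stdForm_self_of_mem_universalWeyl_false {E : Type*} [NormedAddCommGroup E]
    [InnerProductSpace ℂ E] {z : 𝔻} {a : WithLp 2 (E × E)}
    (ha : a ∈ universalWeyl E (false, z)) : (-I * stdForm E E a a).re ≤ 0 := by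
  have h : a.fst = (z : ℂ) • a.snd := ha
  rw [stdForm_self, ← mul_assoc, neg_mul, I_mul_I, neg_neg, one_mul, ofReal_re, h,
    norm_smul, sub_nonpos]
  exact pow_le_pow_left₀ (by positivity)
    (mul_le_of_le_one_left (norm_nonneg _) z.norm_lt_one.le) 2

/-! ### Structure and isotropy of the model relation. -/

section ModelStructure

variable {H : Type*} [NormedAddCommGroup H] [InnerProductSpace ℂ H] [CompleteSpace H]
  {ω : H →ₗ[ℂ] H →ₗ⋆[ℂ] ℂ} {N : 𝔻 → Submodule ℂ H}
  {Hp Hm : Type*} [NormedAddCommGroup Hp] [InnerProductSpace ℂ Hp] [CompleteSpace Hp]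
  [NormedAddCommGroup Hm] [InnerProductSpace ℂ Hm] [CompleteSpace Hm]
  {Ψ : H ≃L[ℂ] WithLp 2 (Hp × Hm)} [hF : Fact (sectionKernel ω N).PosSemidef]
  {κp : Hp →ₗᵢ[ℂ] ModelSpace ω N} {κm : Hm →ₗᵢ[ℂ] ModelSpace ω N}
  {T : WithLp 2 (Hp × Hm) →L[ℂ] WithLp 2 (ModelSpace ω N × ModelSpace ω N)}
  {R : WithLp 2 (ModelSpace ω N × ModelSpace ω N) →L[ℂ] WithLp 2 (Hp × Hm)}

namespace IsModelEmbedding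

omit [CompleteSpace H] in
lemma adjoint_eq_zero (hE : IsModelEmbedding Ψ κp κm T R)
    {a : WithLp 2 (ModelSpace ω N × ModelSpace ω N)} (ha : a ∈ modelRelation ω N) : R a = 0 :=
  (stdForm_isStrongSymplectic Hp Hm).nondegenerate _ fun b => by
    rw [← hE.modelForm_right, hE.orthogonal a ha]

omit [CompleteSpace H] in
lemma modelForm_left (hE : IsModelEmbedding Ψ κp κm T R) (a b) :
    modelForm ω N (T a) b = stdForm Hp Hm a (R b) := by
  rw [modelForm_isStrongSymplectic.skew b (T a), hE.modelForm_right,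
    ← (stdForm_isStrongSymplectic Hp Hm).skew]

omit [CompleteSpace H] in
lemma apply_mem_sympOrth (hE : IsModelEmbedding Ψ κp κm T R) (a) :
    T a ∈ sympOrth (modelForm ω N) (modelRelation ω N) := fun b hb => by
  rw [hE.modelForm_left, hE.adjoint_eq_zero hb, map_zero]

omit [CompleteSpace H] in
lemma adjoint_defectVector (hE : IsModelEmbedding Ψ κp κm T R) (hω : IsStrongSymplectic ω)
    (hΨ : IsSymplecticIso ω (stdForm Hp Hm) Ψ) (s : TotalSpace ω N) :
    R (defectVector s) = Ψ s.2 := by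
  rw [← sub_eq_zero]
  refine (stdForm_isStrongSymplectic Hp Hm).nondegenerate _ fun b => ?_
  rw [map_sub, LinearMap.sub_apply, ← hE.modelForm_right,
    modelForm_isStrongSymplectic.skew (T b), hE.modelForm_defectVector, ← hω.skew, ← hΨ,
    Ψ.apply_symm_apply, sub_self]

/-- Both vectors have the same symplectic product with every defect vector, and 𝔄 is the complement
of the defect vectors. -/
lemma sub_mem_modelRelation (hE : IsModelEmbedding Ψ κp κm T R) (hω : IsStrongSymplectic ω)
    (hN : IsNevanlinnaDisc ω N) (s : TotalSpace ω N) :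
    defectVector s - T (Ψ s.2) ∈ modelRelation ω N := by
  rw [mem_modelRelation_iff]
  intro t
  rw [map_sub, LinearMap.sub_apply, _root_.modelForm_defectVector hω hN,
    hE.modelForm_defectVector, Ψ.symm_apply_apply, sub_self]

omit [CompleteSpace H] in
lemma orthogonal_sub (hE : IsModelEmbedding Ψ κp κm T R)
    {a : WithLp 2 (ModelSpace ω N × ModelSpace ω N)} (ha : a ∈ modelRelation ω N)
    (s : TotalSpace ω N) : modelForm ω N a (defectVector s - T (Ψ s.2)) = 0 := by
  rw [map_sub, (mem_modelRelation_iff a).1 ha, hE.orthogonal a ha, sub_zero]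

/-- `𝔄^{⊥ₛ}` is the sum of the range of `T` and `𝔄`. -/
lemma sub_apply_adjoint_mem (hE : IsModelEmbedding Ψ κp κm T R) (hω : IsStrongSymplectic ω)
    (hN : IsNevanlinnaDisc ω N)
    {a : WithLp 2 (ModelSpace ω N × ModelSpace ω N)}
    (ha : a ∈ sympOrth (modelForm ω N) (modelRelation ω N)) :
    a - T (R a) ∈ modelRelation ω N := by
  rw [mem_modelRelation_iff]
  intro s
  -- Orthogonality to the element d - T(Ψx) of 𝔄 replaces the defect vector d by a vector in the
  -- range of T, where R T = 1 gives 0.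
  have h1 := (sympOrth (modelForm ω N) (modelRelation ω N)).sub_mem ha
    (hE.apply_mem_sympOrth (R a)) _ (hE.sub_mem_modelRelation hω hN s)
  rw [map_sub, sub_eq_zero] at h1
  rw [h1, hE.modelForm_right, map_sub, hE.adjoint_apply, sub_self, map_zero,
    LinearMap.zero_apply]

/-- The span of the differences between defect vectors and the corresponding vectors over the
points `0`. -/
noncomputable def defectDifferences (Ψ : H ≃L[ℂ] WithLp 2 (Hp × Hm))
    (T : WithLp 2 (Hp × Hm) →L[ℂ] WithLp 2 (ModelSpace ω N × ModelSpace ω N)) :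
    Submodule ℂ (WithLp 2 (ModelSpace ω N × ModelSpace ω N)) :=
  Submodule.span ℂ (Set.range fun s : TotalSpace ω N => defectVector s - T (Ψ s.2))

lemma defectDifferences_le (hE : IsModelEmbedding Ψ κp κm T R) (hω : IsStrongSymplectic ω)
    (hN : IsNevanlinnaDisc ω N) : defectDifferences Ψ T ≤ modelRelation ω N := by
  refine Submodule.span_le.2 ?_
  rintro _ ⟨s, rfl⟩
  exact hE.sub_mem_modelRelation hω hN s

omit [CompleteSpace H] in
lemma orthogonal_defectDifferences (hE : IsModelEmbedding Ψ κp κm T R)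
    {a : WithLp 2 (ModelSpace ω N × ModelSpace ω N)} (ha : a ∈ modelRelation ω N)
    {u : WithLp 2 (ModelSpace ω N × ModelSpace ω N)} (hu : u ∈ defectDifferences Ψ T) :
    modelForm ω N a u = 0 := by
  induction hu using Submodule.span_induction with
  | mem u hu => obtain ⟨s, rfl⟩ := hu; exact hE.orthogonal_sub ha s
  | zero => simp
  | add x y _ _ hx hy => rw [map_add, hx, hy, add_zero]
  | smul c x _ hx => simp [hx]

/-- First components of 𝔄 lie in ker κ₊*, and those of the differences are dense there: a vector
orthogonal to them and killed by κ₊* is orthogonal to the first components of all defect vectors,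
hence vanishes on every fibre. -/
lemma fst_mem_closure (hE : IsModelEmbedding Ψ κp κm T R) (hω : IsStrongSymplectic ω)
    (hN : IsNevanlinnaDisc ω N) {a : WithLp 2 (ModelSpace ω N × ModelSpace ω N)}
    (ha : a ∈ modelRelation ω N) :
    a.fst ∈ ((defectDifferences Ψ T).map
      (WithLp.fstL 2 ℂ (ModelSpace ω N) (ModelSpace ω N)).toLinearMap).topologicalClosure := by
  have hzero {b} (hb : b ∈ modelRelation ω N) :
      ContinuousLinearMap.adjoint κp.toContinuousLinearMap b.fst = 0 := by
    have := hE.adjoint_eq_zero hb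
    rw [hE.adjoint_eq] at this
    exact congrArg WithLp.fst this
  refine mem_topologicalClosure_of_adjoint_eq_zero (κ := κp) ?_ ?_ (hzero ha)
  · rintro _ ⟨u, hu, rfl⟩
    exact hzero (hE.defectDifferences_le hω hN hu)
  · intro v hv hv0
    have hinner (s : TotalSpace ω N) : inner ℂ (defectVector s).fst v = (0 : ℂ) := by
      have h1 : inner ℂ (defectVector s - T (Ψ s.2)).fst v = (0 : ℂ) :=
        (Submodule.mem_orthogonal _ _).1 hv _ ⟨_, Submodule.subset_span ⟨s, rfl⟩, rfl⟩
      have h2 : inner ℂ (κp (Ψ s.2).fst) v = (0 : ℂ) := by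
        have := ContinuousLinearMap.adjoint_inner_right κp.toContinuousLinearMap (Ψ s.2).fst v
        rw [hv0, inner_zero_right] at this
        exact this.symm
      rw [WithLp.sub_fst, inner_sub_left, hE.apply_eq] at h1
      have h3 : inner ℂ (defectVector s).fst v - inner ℂ (κp (Ψ s.2).fst) v = (0 : ℂ) := h1
      rwa [h2, sub_zero] at h3
    -- Over 𝔻₊ the first component is λ̄ times a kernel function and carries no information at λ =
    -- 0; that fibre is reached by continuity.
    have hne (z : 𝔻) (hz : z ≠ 0) (x : dualFibre ω N (true, z)) : v ⟨(true, z), x⟩ = 0 := by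
      have := hinner ⟨(true, z), x⟩
      simpa [defectVector, inner_smul_left, inner_modelKer, hz] using this
    ext ⟨⟨_ | _, z⟩, x⟩
    · have := hinner ⟨(false, z), x⟩
      simpa [defectVector, inner_modelKer] using this
    · by_cases hz : z = 0
      · subst hz
        simpa using apply_zero_eq_zero hω hN true v hne x
      · simpa using hne z hz x

/-- Mirror image of `fst_mem_closure`; the exceptional point is now 0 in 𝔻₋. -/
lemma snd_mem_closure (hE : IsModelEmbedding Ψ κp κm T R) (hω : IsStrongSymplectic ω)
    (hN : IsNevanlinnaDisc ω N) {a : WithLp 2 (ModelSpace ω N × ModelSpace ω N)}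
    (ha : a ∈ modelRelation ω N) :
    a.snd ∈ ((defectDifferences Ψ T).map
      (WithLp.sndL 2 ℂ (ModelSpace ω N) (ModelSpace ω N)).toLinearMap).topologicalClosure := by
  have hzero {b} (hb : b ∈ modelRelation ω N) :
      ContinuousLinearMap.adjoint κm.toContinuousLinearMap b.snd = 0 := by
    have := hE.adjoint_eq_zero hb
    rw [hE.adjoint_eq] at this
    exact congrArg WithLp.snd this
  refine mem_topologicalClosure_of_adjoint_eq_zero (κ := κm) ?_ ?_ (hzero ha)
  · rintro _ ⟨u, hu, rfl⟩
    exact hzero (hE.defectDifferences_le hω hN hu)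
  · intro v hv hv0
    have hinner (s : TotalSpace ω N) : inner ℂ (defectVector s).snd v = (0 : ℂ) := by
      have h1 : inner ℂ (defectVector s - T (Ψ s.2)).snd v = (0 : ℂ) :=
        (Submodule.mem_orthogonal _ _).1 hv _ ⟨_, Submodule.subset_span ⟨s, rfl⟩, rfl⟩
      have h2 : inner ℂ (κm (Ψ s.2).snd) v = (0 : ℂ) := by
        have := ContinuousLinearMap.adjoint_inner_right κm.toContinuousLinearMap (Ψ s.2).snd v
        rw [hv0, inner_zero_right] at this
        exact this.symm
      rw [WithLp.sub_snd, inner_sub_left, hE.apply_eq] at h1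
      have h3 : inner ℂ (defectVector s).snd v - inner ℂ (κm (Ψ s.2).snd) v = (0 : ℂ) := h1
      rwa [h2, sub_zero] at h3
    have hne (z : 𝔻) (hz : z ≠ 0) (x : dualFibre ω N (false, z)) : v ⟨(false, z), x⟩ = 0 := by
      have := hinner ⟨(false, z), x⟩
      simpa [defectVector, inner_smul_left, inner_modelKer, hz] using this
    ext ⟨⟨_ | _, z⟩, x⟩
    · by_cases hz : z = 0
      · subst hz
        simpa using apply_zero_eq_zero hω hN false v hne x
      · simpa using hne z hz x
    · have := hinner ⟨(true, z), x⟩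
      simpa [defectVector, inner_modelKer] using this

/-- The model relation is isotropic. -/
theorem isIsotropic (hE : IsModelEmbedding Ψ κp κm T R) (hω : IsStrongSymplectic ω)
    (hN : IsNevanlinnaDisc ω N) : IsIsotropic (modelForm ω N) (modelRelation ω N) := by
  -- For a difference u, [u,u] = 0 gives ‖u₁‖ = ‖u₂‖ and [a,u] = 0 gives (a₁,u₁) = (a₂,u₂). So
  -- |(a₁,u₁)| ≤ ‖u₁‖‖a₂‖, which by density yields ‖a₁‖ ≤ ‖a₂‖; the converse is symmetric.
  have hself {a} (ha : a ∈ modelRelation ω N) : modelForm ω N a a = 0 := by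
    have hn {u} (hu : u ∈ defectDifferences Ψ T) : ‖u.fst‖ = ‖u.snd‖ :=
      norm_fst_eq_norm_snd (hE.orthogonal_defectDifferences (hE.defectDifferences_le hω hN hu) hu)
    have hi {u} (hu : u ∈ defectDifferences Ψ T) :
        inner ℂ u.fst a.fst = (inner ℂ u.snd a.snd : ℂ) := by
      have := hE.orthogonal_defectDifferences ha hu
      rw [stdForm_apply, sub_eq_zero] at this
      exact mul_left_cancel₀ I_ne_zero this
    have h1 : ‖a.fst‖ ≤ ‖a.snd‖ := by
      refine norm_le_of_mem_topologicalClosure (norm_nonneg _) ?_ (hE.fst_mem_closure hω hN ha)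
      rintro _ ⟨u, hu, rfl⟩
      change ‖inner ℂ u.fst a.fst‖ ≤ ‖u.fst‖ * ‖a.snd‖
      rw [hi hu, hn hu]
      exact norm_inner_le_norm _ _
    have h2 : ‖a.snd‖ ≤ ‖a.fst‖ := by
      refine norm_le_of_mem_topologicalClosure (norm_nonneg _) ?_ (hE.snd_mem_closure hω hN ha)
      rintro _ ⟨u, hu, rfl⟩
      change ‖inner ℂ u.snd a.snd‖ ≤ ‖u.snd‖ * ‖a.fst‖
      rw [← hi hu, ← hn hu]
      exact norm_inner_le_norm _ _
    rw [stdForm_self, le_antisymm h1 h2]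
    simp
  refine ⟨isClosed_modelRelation, fun a ha b hb => ?_⟩
  -- Polarization with a + b and a + ib.
  have h1 := hself ((modelRelation ω N).add_mem ha hb)
  have h2 := hself ((modelRelation ω N).add_mem ha ((modelRelation ω N).smul_mem I hb))
  simp only [map_add, LinearMap.add_apply, hself ha, hself hb, map_smul, LinearMap.smul_apply,
    LinearMap.map_smulₛₗ, smul_eq_mul, conj_I, mul_zero, add_zero, zero_add] at h1 h2
  linear_combination (1 / 2 : ℂ) * h1 + (I / 2) * h2 +
    (1 / 2 : ℂ) * (modelForm ω N a b - modelForm ω N b a) * I_mul_I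

end IsModelEmbedding

end ModelStructure

/-! ### The quotient and its Weyl curve -/

section WeylCurve

lemma quotForm_mkQ {H : Type*} [SeminormedAddCommGroup H] [NormedSpace ℂ H]
    {ω : H →ₗ[ℂ] H →ₗ⋆[ℂ] ℂ} (hω : IsStrongSymplectic ω) (A : Submodule ℂ H)
    (a b : sympOrth ω A) :
    quotForm hω A ((A.submoduleOf (sympOrth ω A)).mkQ a) ((A.submoduleOf (sympOrth ω A)).mkQ b) =
      ω a b :=
  rfl

variable {H : Type*} [NormedAddCommGroup H] [InnerProductSpace ℂ H] [CompleteSpace H]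
  {ω : H →ₗ[ℂ] H →ₗ⋆[ℂ] ℂ} {N : 𝔻 → Submodule ℂ H}
  {Hp Hm : Type*} [NormedAddCommGroup Hp] [InnerProductSpace ℂ Hp] [CompleteSpace Hp]
  [NormedAddCommGroup Hm] [InnerProductSpace ℂ Hm] [CompleteSpace Hm]
  {Ψ : H ≃L[ℂ] WithLp 2 (Hp × Hm)} [hF : Fact (sectionKernel ω N).PosSemidef]
  {κp : Hp →ₗᵢ[ℂ] ModelSpace ω N} {κm : Hm →ₗᵢ[ℂ] ModelSpace ω N}
  {T : WithLp 2 (Hp × Hm) →L[ℂ] WithLp 2 (ModelSpace ω N × ModelSpace ω N)}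
  {R : WithLp 2 (ModelSpace ω N × ModelSpace ω N) →L[ℂ] WithLp 2 (Hp × Hm)}

/-- `𝔄^{⊥ₛ} / 𝔄` is symplectically isomorphic to `H` by the map induced by `Ψ⁻¹ R`. -/
lemma IsModelEmbedding.exists_quotient_equiv (hE : IsModelEmbedding Ψ κp κm T R)
    (hω : IsStrongSymplectic ω) (hN : IsNevanlinnaDisc ω N)
    (hΨ : IsSymplecticIso ω (stdForm Hp Hm) Ψ) :
    ∃ Φ : SympQuot (modelForm ω N) (modelRelation ω N) ≃L[ℂ] H,
      IsSymplecticIso (modelQuotForm ω N) ω Φ ∧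
      ∀ a : sympOrth (modelForm ω N) (modelRelation ω N),
        Φ (((modelRelation ω N).submoduleOf _).mkQ a) = Ψ.symm (R a) := by
  let S := sympOrth (modelForm ω N) (modelRelation ω N)
  let A := (modelRelation ω N).submoduleOf S
  let f : S ⧸ A →L[ℂ] H := A.liftQL ((Ψ.symm : _ →L[ℂ] H) ∘L R ∘L S.subtypeL) fun a ha => by
    have : R (a : WithLp 2 (ModelSpace ω N × ModelSpace ω N)) = 0 := hE.adjoint_eq_zero ha
    simp [this]
  let g : H →L[ℂ] S ⧸ A := A.mkQL ∘L
    (T ∘L (Ψ : H →L[ℂ] WithLp 2 (Hp × Hm))).codRestrict S fun x => hE.apply_mem_sympOrth _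
  have hf (a : S) : f (A.mkQ a) = Ψ.symm (R a) := rfl
  have hg (x : H) : g x = A.mkQ ⟨T (Ψ x), hE.apply_mem_sympOrth _⟩ := rfl
  have hform (q r : S ⧸ A) : ω (f q) (f r) = modelQuotForm ω N q r := by
    obtain ⟨a, rfl⟩ := A.mkQ_surjective q
    obtain ⟨b, rfl⟩ := A.mkQ_surjective r
    rw [hf, hf, quotForm_mkQ]
    -- b may be replaced by T(Rb), because they differ by an element of 𝔄 and a is orthogonal to 𝔄.
    have h1 := a.2 _ (hE.sub_apply_adjoint_mem hω hN b.2)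
    rw [map_sub, sub_eq_zero] at h1
    rw [h1, hE.modelForm_right, ← hΨ, Ψ.apply_symm_apply, Ψ.apply_symm_apply]
  refine ⟨ContinuousLinearEquiv.equivOfInverse f g (fun q => ?_) (fun x => ?_), hform, hf⟩
  · obtain ⟨a, rfl⟩ := A.mkQ_surjective q
    rw [hf, hg, eq_comm, Submodule.mkQ_apply, Submodule.mkQ_apply, Submodule.Quotient.eq]
    change (a : WithLp 2 (ModelSpace ω N × ModelSpace ω N)) - T (Ψ (Ψ.symm (R a))) ∈
      modelRelation ω N
    rw [Ψ.apply_symm_apply]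
    exact hE.sub_apply_adjoint_mem hω hN a.2
  · rw [hg, hf, hE.adjoint_apply, Ψ.symm_apply_apply]

/-- The Weyl curve of `𝔄` is congruent to the extension of `N` to both discs. -/
theorem exists_isSymplecticIso_weylCurve (hω : IsStrongSymplectic ω)
    (hN : IsNevanlinnaDisc ω N) :
    ∃ Φ : SympQuot (modelForm ω N) (modelRelation ω N) ≃L[ℂ] H,
      IsSymplecticIso (modelQuotForm ω N) ω Φ ∧
      ∀ p, (weylCurve (modelRelation ω N) p).map (Φ : _ →ₗ[ℂ] H) = extendDisc ω N p := by
  have : CompleteSpace (N 0) := (hN.1 0).1.completeSpace_coe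
  have : CompleteSpace (sympOrth ω (N 0)) := (hω.isClosed_sympOrth _).completeSpace_coe
  obtain ⟨Ψ, B, h, hB0⟩ := hN.exists_standardRepresentation hω
  obtain ⟨κp, κm, T, R, hE⟩ := h.exists_isModelEmbedding hω hN hB0
  obtain ⟨Φ, hΦ, hΦR⟩ := hE.exists_quotient_equiv hω hN h.1
  have hge (p : TwoDiscs) :
      extendDisc ω N p ≤ (weylCurve (modelRelation ω N) p).map (Φ : _ →ₗ[ℂ] H) := by
    intro x hx
    have hx' : x ∈ dualFibre ω N p.conj := by rwa [dualFibre, p.conj_conj]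
    refine ⟨_, ⟨⟨_, defectVector_mem_sympOrth ⟨p.conj, x, hx'⟩⟩,
      defectVector_mem_universalWeyl p ⟨x, hx'⟩, rfl⟩, ?_⟩
    refine (hΦR _).trans ?_
    rw [hE.adjoint_defectVector hω h.1, Ψ.symm_apply_apply]
  have hform (a : sympOrth (modelForm ω N) (modelRelation ω N)) :
      ω (Φ (((modelRelation ω N).submoduleOf _).mkQ a))
        (Φ (((modelRelation ω N).submoduleOf _).mkQ a)) = modelForm ω N a a := by
    rw [hΦ, quotForm_mkQ]
  refine ⟨Φ, hΦ, fun p => le_antisymm ?_ (hge p)⟩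
  obtain ⟨_ | _, z⟩ := p
  -- The N(λ̄)-component of x also lies in the image of the Weyl curve over 𝔻₋, where -i[·,·] is
  -- non-positive; being in a positive subspace, it vanishes.
  · rintro x hx
    obtain ⟨l, hl, l', hl', rfl⟩ := Submodule.mem_sup.1
      ((hω.isCompl_sympOrth (hN.1 (star z))).sup_eq_top ▸ Submodule.mem_top :
        x ∈ N (star z) ⊔ sympOrth ω (N (star z)))
    have hlz : l ∈ (weylCurve (modelRelation ω N) (false, z)).map (Φ : _ →ₗ[ℂ] H) := by
      simpa using Submodule.sub_mem _ hx (hge (false, z) hl')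
    obtain ⟨_, ⟨a, ha, rfl⟩, rfl⟩ := hlz
    by_cases hl0 : Φ (((modelRelation ω N).submoduleOf _).mkQ a) = 0
    · have : (Φ : _ →ₗ[ℂ] H) (((modelRelation ω N).submoduleOf _).mkQ a) = 0 := hl0
      rw [this, zero_add]
      exact hl'
    · have h1 := (hN.1 (star z)).2.1 _ hl hl0
      have h2 : (-I * modelForm ω N a a).re ≤ 0 := re_stdForm_self_of_mem_universalWeyl_false ha
      rw [← hform] at h2
      exact absurd h1 h2.not_gt
  -- Over 𝔻₊ the image of the Weyl curve is a positive subspace containing N(λ), so maximality gives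
  -- equality.
  · refine ((hN.1 z).2.2.1 _ ?_ (hge (true, z))).le
    rintro _ ⟨_, ⟨a, ha, rfl⟩, rfl⟩ ha0
    have ha0' : (a : WithLp 2 (ModelSpace ω N × ModelSpace ω N)) ≠ 0 := by
      intro h0
      have : a = 0 := Subtype.ext h0
      exact ha0 (by rw [this, map_zero, map_zero])
    have h1 : 0 < (-I * modelForm ω N a a).re := re_stdForm_self_of_mem_universalWeyl_true ha ha0'
    rw [← hform] at h1
    exact h1

end WeylCurve

/-! ### Boundary quadruples from congruences. -/

section BoundaryQuadruple

variable {H : Type*} [NormedAddCommGroup H] [InnerProductSpace ℂ H]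
  {ω : H →ₗ[ℂ] H →ₗ⋆[ℂ] ℂ} {N : 𝔻 → Submodule ℂ H}
  {E : Type*} [NormedAddCommGroup E] [InnerProductSpace ℂ E] [CompleteSpace E]
  {A : Submodule ℂ (WithLp 2 (E × E))}
  {Hp Hm : Type*} [NormedAddCommGroup Hp] [InnerProductSpace ℂ Hp] [CompleteSpace Hp]
  [NormedAddCommGroup Hm] [InnerProductSpace ℂ Hm] [CompleteSpace Hm]
  {Ψ : H ≃L[ℂ] WithLp 2 (Hp × Hm)} {B : ℂ → (Hp →L[ℂ] Hm)}
  {Φ : SympQuot (stdForm E E) A ≃L[ℂ] H}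

/-- If the Weyl curve of `A` is congruent to `N`, then every Schur function representing `N` is the
contractive Weyl function of a boundary quadruple. -/
theorem exists_isBoundaryQuadruple
    (hΦ : IsSymplecticIso (quotForm (stdForm_isStrongSymplectic E E) A) ω Φ)
    (hW : ∀ p, (weylCurve A p).map (Φ : _ →ₗ[ℂ] H) = extendDisc ω N p)
    (h : IsStandardRepresentation ω N Ψ B) :
    ∃ (Γp : sympOrth (stdForm E E) A →L[ℂ] Hp) (Γm : sympOrth (stdForm E E) A →L[ℂ] Hm),
      IsBoundaryQuadruple A Γp Γm ∧ IsContractiveWeylFunction A Γp Γm B := by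
  -- The quotient map, the congruence and the given representation compose to a boundary map sending
  -- N_λ onto Ψ(𝒩(λ)).
  let Γ : sympOrth (stdForm E E) A →L[ℂ] WithLp 2 (Hp × Hm) :=
    (Ψ : H →L[ℂ] WithLp 2 (Hp × Hm)) ∘L (Φ : _ →L[ℂ] H) ∘L (A.submoduleOf _).mkQL
  have himage (p : TwoDiscs) :
      Γ '' (weylDefect A p : Set (sympOrth (stdForm E E) A)) = Ψ '' (extendDisc ω N p : Set H) := by
    rw [← hW, weylCurve, Submodule.map_coe, Submodule.map_coe, Set.image_image, Set.image_image]
    rfl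
  refine ⟨WithLp.fstL 2 ℂ Hp Hm ∘L Γ, WithLp.sndL 2 ℂ Hp Hm ∘L Γ, ⟨Φ.trans Ψ, fun x y => ?_,
    fun a => rfl⟩, h.2.1, fun z => ?_, fun z => ?_⟩
  · rw [← hΦ, ← h.1]
    rfl
  · exact (himage (true, z)).trans (h.2.2 z)
  · refine (himage (false, z)).trans ?_
    have hmem (x : H) : x ∈ extendDisc ω N (false, z) ↔
        (Ψ x).fst = ContinuousLinearMap.adjoint (B (conj (z : ℂ))) (Ψ x).snd :=
      h.mem_sympOrth_iff (star z) x
    ext a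
    constructor
    · rintro ⟨x, hx, rfl⟩
      refine ⟨(Ψ x).snd, WithLp.ofLp_injective 2 (Prod.ext ((hmem x).1 hx) rfl)⟩
    · rintro ⟨y, rfl⟩
      refine ⟨Ψ.symm (WithLp.toLp 2 (ContinuousLinearMap.adjoint (B (conj (z : ℂ))) y, y)), ?_,
        Ψ.apply_symm_apply _⟩
      rw [SetLike.mem_coe, hmem, Ψ.apply_symm_apply, WithLp.toLp_fst, WithLp.toLp_snd]

end BoundaryQuadruple

/-! ### The model theorem. -/

theorem mainTheorem7 {H : Type u} [NormedAddCommGroup H] [InnerProductSpace ℂ H] [CompleteSpace H]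
    (ω : H →ₗ[ℂ] H →ₗ⋆[ℂ] ℂ) (hω : IsStrongSymplectic ω)
    (N : 𝔻 → Submodule ℂ H) (hN : IsNevanlinnaDisc ω N) :
    -- the kernel of the Nevanlinna disc is positive, so that it generates `𝔥`
    ∃ _ : Fact (sectionKernel ω N).PosSemidef,
      -- `𝔄` is isotropic in `𝔥 ⊕ 𝔥`, and `𝔄^{⊥ₛ} / 𝔄` is strong symplectic
      IsIsotropic (modelForm ω N) (modelRelation ω N) ∧
      IsStrongSymplectic (modelQuotForm ω N) ∧
      -- the Weyl curve of `𝔄` is a Nevanlinna disc (with its canonical second branch) ...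
      IsNevanlinnaDisc (modelQuotForm ω N) (fun z => weylCurve (modelRelation ω N) (true, z)) ∧
      (∀ p, weylCurve (modelRelation ω N) p =
        extendDisc (modelQuotForm ω N) (fun z => weylCurve (modelRelation ω N) (true, z)) p) ∧
      -- ... congruent to `N`
      CongruentDiscs (modelQuotForm ω N) (fun z => weylCurve (modelRelation ω N) (true, z)) ω N ∧
      -- the polarization `N(0)` represents `N` by a Schur function `B` (with `B(0) = 0`)
      (∃ (Hp Hm : Type u) (_ : NormedAddCommGroup Hp) (_ : InnerProductSpace ℂ Hp)
        (_ : NormedAddCommGroup Hm) (_ : InnerProductSpace ℂ Hm)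
        (_ : CompleteSpace Hp) (_ : CompleteSpace Hm)
        (Ψ : H ≃L[ℂ] WithLp 2 (Hp × Hm)) (B : ℂ → (Hp →L[ℂ] Hm)),
        IsStandardRepresentation ω N Ψ B ∧ B 0 = 0) ∧
      -- whenever `B` represents `N`, it is the contractive Weyl function of a boundary quadruple
      (∀ (Hp : Type v) (Hm : Type w) [NormedAddCommGroup Hp] [InnerProductSpace ℂ Hp]
        [NormedAddCommGroup Hm] [InnerProductSpace ℂ Hm] [CompleteSpace Hp] [CompleteSpace Hm]
        (Ψ : H ≃L[ℂ] WithLp 2 (Hp × Hm)) (B : ℂ → (Hp →L[ℂ] Hm)),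
        IsStandardRepresentation ω N Ψ B →
        ∃ (Γp : sympOrth (modelForm ω N) (modelRelation ω N) →L[ℂ] Hp)
          (Γm : sympOrth (modelForm ω N) (modelRelation ω N) →L[ℂ] Hm),
          IsBoundaryQuadruple (modelRelation ω N) Γp Γm ∧
          IsContractiveWeylFunction (modelRelation ω N) Γp Γm B) := by
  have hF : Fact (sectionKernel ω N).PosSemidef := ⟨posSemidef_sectionKernel hω hN⟩
  obtain ⟨Φ, hΦ, hW⟩ := exists_isSymplecticIso_weylCurve hω hN
  have hmem (p : TwoDiscs) (q : SympQuot (modelForm ω N) (modelRelation ω N)) :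
      q ∈ weylCurve (modelRelation ω N) p ↔ Φ q ∈ extendDisc ω N p := by
    rw [← hW]
    exact (Φ.injective.mem_set_image (s := (weylCurve (modelRelation ω N) p : Set _))).symm
  have hNW (z : 𝔻) : Φ '' (weylCurve (modelRelation ω N) (true, z) : Set _) = (N z : Set H) :=
    congrArg (SetLike.coe : Submodule ℂ H → Set H) (hW (true, z))
  have : CompleteSpace (N 0) := (hN.1 0).1.completeSpace_coe
  have : CompleteSpace (sympOrth ω (N 0)) := (hω.isClosed_sympOrth _).completeSpace_coe
  obtain ⟨Ψ, B, h, hB0⟩ := hN.exists_standardRepresentation hω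
  obtain ⟨κp, κm, T, R, hE⟩ := h.exists_isModelEmbedding hω hN hB0
  refine ⟨hF, hE.isIsotropic hω hN, hΦ.isStrongSymplectic hω, hΦ.isNevanlinnaDisc hNW hN, ?_,
    ⟨Φ, hΦ, hNW⟩, ⟨N 0, sympOrth ω (N 0), _, _, _, _, ‹_›, ‹_›, Ψ, B, h, hB0⟩, ?_⟩
  -- On the second branch membership is read off in `H` through `Φ`, where the fibre is a symplectic
  -- complement by definition.
  · rintro ⟨_ | _, z⟩
    · ext q
      rw [hmem]
      constructor
      · intro hq r hr
        rw [← hΦ]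
        exact hq _ ((hmem (true, star z) r).1 hr)
      · intro hq y hy
        have h1 := hq (Φ.symm y) ((hmem (true, star z) _).2 (by rwa [Φ.apply_symm_apply]))
        rwa [← hΦ, Φ.apply_symm_apply] at h1
    · rfl
  · intro Hp Hm _ _ _ _ _ _ Ψ' B' h'
    exact exists_isBoundaryQuadruple hΦ hW h'
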